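/- **Setting.** A geodesic in a metric space $X$ is an isometric embedding of an interval of $\mathbb R$ (identified with its image). For $K\ge 1$, $C\ge 0$, a map $f:X\to Y$ of metric spaces is a $(K,C)$-quasi-isometric embedding if $\frac1K d_X(x,x')-C\le d_Y(f(x),f(x'))\le K d_X(x,x')+C$ for all $x,x'\in X$. It is a quasi-isometry if, for some $K\ge1$, $C\ge0$, it is a $(K,C)$-quasi-isometric embedding and every point of $Y$ is at distance at most $C$ from $f(X)$. A $(K,C)$-quasi-geodesic is a $(K,C)$-quasi-isometric embedding of a compact interval. A Morse gauge is a function $N:\mathbb R_{\ge1}\times\mathbb R_{\ge0}\to\mathbb R_{\ge0}$; a geodesic $\alpha$ is $N$-Morse if every $(K,C)$-quasi-geodesic with endpoints on $\alpha$ lies in the closed $N(K,C)$-neighbourhood of $\alpha$, and Morse if it is $N$-Morse for some $N$. The Morse boundary $\partial_*X$ is the set of Morse geodesic rays in $X$ modulo finite Hausdorff distance; a bi-infinite geodesic joins $p,q\in\partial_*X$ if its two half-rays are at finite Hausdorff distance from rays representing $p$ and $q$. Let $\partial_*X^{(3,N)}$ be the set of triples of distinct points of $\partial_*X$ such that every bi-infinite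 geodesic joining two of them is $N$-Morse, and, for $K\ge0$, let $E_K(p,q,r)$ be the set of points of $X$ within distance $K$ of each of the three sides of some ideal triangle (three bi-infinite geodesics joining the pairs) with vertices $p,q,r$. A proper geodesic metric space $X$ is *center-exhaustive* if there are a Morse gauge $N$ and $K\ge 0$ such that every $x\in X$ lies in $E_K(p,q,r)$ for some $(p,q,r)\in\partial_*X^{(3,N)}$. It is *Morse geodesically rich* if there are a Morse gauge $N_0$ and $C_0>0$ such that for every Morse gauge $N$ there is a constant $C_1$ with the following property: whenever $x_1,x_2\in X$ are joined by an $N$-Morse geodesic, there is a bi-infinite $N_0$-Morse geodesic $\alpha$ with $d(x_1,\alpha)<C_0$ and $|d(x_1,x_2)-d(x_2,\alpha)|<C_1$. **Proposition.** Let $X$ and $Y$ be proper geodesic metric spaces and let $f:X\to Y$ be a quasi-isometry. 1. If $X$ is center-exhaustive, then $Y$ is center-exhaustive. 2. $X$ is center-exhaustive if and only if $X$ is Morse geodesically rich. 3. If $X$ is Morse geodesically rich, then $Y$ is Morse geodesically rich. -/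

import Mathlib

open Set Metric
open scoped NNReal

/-- A metric space is geodesic if any two points are joined by an isometrically embedded
compact interval. -/
def IsGeodesicSpace (X : Type*) [MetricSpace X] : Prop :=
  ∀ x y : X, ∃ (L : ℝ≥0) (γ : Icc (0 : ℝ) L → X),
    Isometry γ ∧ γ ⟨0, le_rfl, L.2⟩ = x ∧ γ ⟨L, L.2, le_rfl⟩ = y

/-- `(K, C)`-quasi-isometric embeddings. -/
def IsQIEmbedding {X Y : Type*} [MetricSpace X] [MetricSpace Y] (K C : ℝ) (f : X → Y) : Prop :=
  1 ≤ K ∧ 0 ≤ C ∧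
    ∀ x x' : X, 1 / K * dist x x' - C ≤ dist (f x) (f x') ∧
      dist (f x) (f x') ≤ K * dist x x' + C

/-- Quasi-isometries: `(K, C)`-quasi-isometric embeddings with `C`-dense image, for some `K`, `C`.
`Metric.cthickening C A` is the set of points at distance at most `C` from `A`; it is empty
if `A` is empty. -/
def IsQuasiIsometry {X Y : Type*} [MetricSpace X] [MetricSpace Y] (f : X → Y) : Prop :=
  ∃ K C : ℝ, IsQIEmbedding K C f ∧ cthickening C (range f) = univ

/-- Morse gauges. Only the values at `(K, C)` with `1 ≤ K` and `0 ≤ C` are ever used. -/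
abbrev MorseGauge : Type := ℝ → ℝ → ℝ≥0

/-- `IsMorse N A`, for `A` the image of a geodesic: every `(K, C)`-quasi-geodesic `q` with
endpoints on `A` stays in the closed `N K C`-neighbourhood of `A`. A quasi-geodesic is a
quasi-isometric embedding of an interval, not necessarily continuous. -/
def IsMorse {X : Type*} [MetricSpace X] (N : MorseGauge) (A : Set X) : Prop :=
  ∀ (K C a b : ℝ) (hab : a ≤ b) (q : Icc a b → X), IsQIEmbedding K C q →
    q ⟨a, le_rfl, hab⟩ ∈ A → q ⟨b, hab, le_rfl⟩ ∈ A → range q ⊆ cthickening (N K C) A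

/-- Two rays (or any two maps into `X`) are asymptotic if their images are at finite
Hausdorff distance. -/
def Asymptotic {X : Type*} [MetricSpace X] (σ τ : ℝ≥0 → X) : Prop :=
  hausdorffEDist (range σ) (range τ) ≠ ⊤

/-- Morse geodesic rays, with arbitrary starting point. -/
def MorseRay (X : Type*) [MetricSpace X] : Type _ :=
  {σ : ℝ≥0 → X // Isometry σ ∧ ∃ N : MorseGauge, IsMorse N (range σ)}

instance MorseRay.setoid (X : Type*) [MetricSpace X] : Setoid (MorseRay X) where
  r σ τ := Asymptotic σ.1 τ.1
  iseqv :=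
    { refl := fun σ => by simp [Asymptotic]
      symm := fun {σ τ} h => by
        unfold Asymptotic at *
        rwa [hausdorffEDist_comm]
      trans := fun {σ τ ρ} h₁ h₂ =>
        ne_top_of_le_ne_top (ENNReal.add_ne_top.2 ⟨h₁, h₂⟩) hausdorffEDist_triangle }

/-- The Morse boundary, as a set. -/
def MorseBoundary (X : Type*) [MetricSpace X] : Type _ :=
  Quotient (MorseRay.setoid X)

/-- The map `σ` defines the boundary point `p`. -/
def ConvergesTo {X : Type*} [MetricSpace X] (σ : ℝ≥0 → X) (p : MorseBoundary X) : Prop :=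
  ∃ τ : MorseRay X, Quotient.mk (MorseRay.setoid X) τ = p ∧ Asymptotic σ τ.1

/-- `α` is a bi-infinite geodesic from `p` to `q`. -/
def IsLineFromTo {X : Type*} [MetricSpace X] (α : ℝ → X) (p q : MorseBoundary X) : Prop :=
  Isometry α ∧ ConvergesTo (fun t : ℝ≥0 => α (-(t : ℝ))) p ∧
    ConvergesTo (fun t : ℝ≥0 => α (t : ℝ)) q

/-- The set of `n`-tuples of distinct points of the Morse boundary such that every bi-infinite
geodesic joining two of them is `N`-Morse. -/
def morseTuples (X : Type*) [MetricSpace X] (n : ℕ) (N : MorseGauge) :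
    Set (Fin n → MorseBoundary X) :=
  {p | Function.Injective p ∧
    ∀ i j : Fin n, i ≠ j → ∀ α : ℝ → X, IsLineFromTo α (p i) (p j) → IsMorse N (range α)}

/-- The set of `K`-centers of `(p, q, r)`: points within `K` of all three sides of some ideal
triangle with vertices `p`, `q`, `r`. -/
def coarseCenters {X : Type*} [MetricSpace X] (K : ℝ) (p q r : MorseBoundary X) : Set X :=
  {x | ∃ α β γ : ℝ → X, IsLineFromTo α p q ∧ IsLineFromTo β q r ∧ IsLineFromTo γ r p ∧
    x ∈ cthickening K (range α) ∧ x ∈ cthickening K (range β) ∧ x ∈ cthickening K (range γ)}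

/-- Center-exhaustive spaces. -/
def CenterExhaustive (X : Type*) [MetricSpace X] : Prop :=
  ∃ (N : MorseGauge) (K : ℝ), 0 ≤ K ∧ ∀ x : X, ∃ p q r : MorseBoundary X,
    ![p, q, r] ∈ morseTuples X 3 N ∧ x ∈ coarseCenters K p q r

/-- `x` and `y` are joined by an `N`-Morse geodesic segment. -/
def JoinedByMorse {X : Type*} [MetricSpace X] (N : MorseGauge) (x y : X) : Prop :=
  ∃ (L : ℝ≥0) (γ : Icc (0 : ℝ) L → X), Isometry γ ∧ γ ⟨0, le_rfl, L.2⟩ = x ∧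
    γ ⟨L, L.2, le_rfl⟩ = y ∧ IsMorse N (range γ)

/-- `(N₀, C₀)`-Morse geodesically rich spaces. -/
def MorseGeodesicallyRichWith (X : Type*) [MetricSpace X] (N₀ : MorseGauge) (C₀ : ℝ) : Prop :=
  ∀ N : MorseGauge, ∃ C₁ : ℝ, ∀ x₁ x₂ : X, JoinedByMorse N x₁ x₂ →
    ∃ α : ℝ → X, Isometry α ∧ IsMorse N₀ (range α) ∧ infDist x₁ (range α) < C₀ ∧
      |dist x₁ x₂ - infDist x₂ (range α)| < C₁

/-- Morse geodesically rich spaces. -/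
def MorseGeodesicallyRich (X : Type*) [MetricSpace X] : Prop :=
  ∃ (N₀ : MorseGauge) (C₀ : ℝ), 0 < C₀ ∧ MorseGeodesicallyRichWith X N₀ C₀

/-! Two facts suffice: center-exhaustiveness is a quasi-isometry invariant, and it is equivalent to
richness. Statement 3 then passes through center-exhaustiveness.

Invariance: a quasi-isometry sends a Morse line to a quasi-geodesic with Morse image, which in a
proper space is uniformly near a Morse geodesic line (`exists_morse_line_near`). The sides of an
ideal triangle centered at `x` thus yield lines passing near `f x`, and they share ends because the
original sides do. Lines with the same ends as a Morse line are uniformly Morse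
(`exists_gauge_same_ends`), so the new triple has a controlled gauge.

Exhaustive implies rich: take an ideal triangle centered at `x₁`. If a side violates the required
estimate, the Morse segment from `x₁` follows one end of that side (`IsMorse.near_of_infDist_le`).
The segment can head towards at most one vertex, and the opposite side does not end there, so some
side works.

Rich implies exhaustive: a degenerate segment at `x` gives a Morse line `α` near `x`; a long segment
of `α` then gives a line `β` near `α 0` that avoids `α T`. One half of `β` also avoids `α (-T)`, so
it diverges linearly from both halves of `α` (`IsMorse.add_le_of_diverge`). Joined to each half, it
gives the two missing sides (`exists_line_joining_rays`).

The recurring device is `IsQuasiGeodesicOn.exists_concat`: leaving a path at an almost nearest point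
to `o` and going straight to `o` gives a quasi-geodesic, to which a Morse hypothesis applies. A
coarse intermediate value theorem replaces continuity. -/

/-- `q` restricts to a `(K, C)`-quasi-isometric embedding of `s ⊆ ℝ`. -/
def IsQuasiGeodesicOn {X : Type*} [MetricSpace X] (K C : ℝ) (q : ℝ → X) (s : Set ℝ) : Prop :=
  1 ≤ K ∧ 0 ≤ C ∧ ∀ v ∈ s, ∀ w ∈ s, v ≤ w →
    (w - v) / K - C ≤ dist (q v) (q w) ∧ dist (q v) (q w) ≤ K * (w - v) + C

/-! ### Quasi-geodesics, and stability of the Morse property -/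

section QuasiGeodesics

variable {X : Type*} [MetricSpace X] {K C : ℝ} {q : ℝ → X} {s : Set ℝ}

namespace IsQuasiGeodesicOn

theorem mono {t : Set ℝ} (h : IsQuasiGeodesicOn K C q s) (hts : t ⊆ s) :
    IsQuasiGeodesicOn K C q t :=
  ⟨h.1, h.2.1, fun v hv w hw => h.2.2 v (hts hv) w (hts hw)⟩

theorem lower (h : IsQuasiGeodesicOn K C q s) {v w : ℝ} (hv : v ∈ s) (hw : w ∈ s) :
    |v - w| ≤ K * (dist (q v) (q w) + C) := by
  have hK : 0 < K := by linarith [h.1]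
  rcases le_total v w with hvw | hvw
  · have := (h.2.2 v hv w hw hvw).1
    rw [abs_sub_comm, abs_of_nonneg (by linarith)]
    rw [sub_le_iff_le_add, div_le_iff₀ hK] at this
    linarith
  · have := (h.2.2 w hw v hv hvw).1
    rw [abs_of_nonneg (by linarith)]
    rw [sub_le_iff_le_add, div_le_iff₀ hK] at this
    rw [dist_comm]
    linarith

theorem upper (h : IsQuasiGeodesicOn K C q s) {v w : ℝ} (hv : v ∈ s) (hw : w ∈ s) :
    dist (q v) (q w) ≤ K * |v - w| + C := by
  rcases le_total v w with hvw | hvw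
  · rw [abs_sub_comm, abs_of_nonneg (by linarith)]
    exact (h.2.2 v hv w hw hvw).2
  · rw [abs_of_nonneg (by linarith), dist_comm]
    exact (h.2.2 w hw v hv hvw).2

theorem of_bounds (hK : 1 ≤ K) (hC : 0 ≤ C)
    (hl : ∀ v ∈ s, ∀ w ∈ s, v ≤ w → w - v ≤ K * (dist (q v) (q w) + C))
    (hu : ∀ v ∈ s, ∀ w ∈ s, v ≤ w → dist (q v) (q w) ≤ K * (w - v) + C) :
    IsQuasiGeodesicOn K C q s := by
  refine ⟨hK, hC, fun v hv w hw hvw => ⟨?_, hu v hv w hw hvw⟩⟩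
  rw [sub_le_iff_le_add, div_le_iff₀ (by linarith)]
  linarith [hl v hv w hw hvw]

/-- Moving every point by at most `D` preserves quasi-geodesics. -/
theorem perturb {q' : ℝ → X} {D : ℝ} (h : IsQuasiGeodesicOn K C q s)
    (hD : ∀ v ∈ s, dist (q v) (q' v) ≤ D) (hD0 : 0 ≤ D) :
    IsQuasiGeodesicOn K (C + 2 * D) q' s := by
  refine ⟨h.1, by linarith [h.2.1], fun v hv w hw hvw => ?_⟩
  have h1 := h.2.2 v hv w hw hvw
  have h2 := hD v hv
  have h3 := hD w hw
  have h4 := dist_triangle4 (q v) (q' v) (q' w) (q w)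
  have h5 := dist_triangle4 (q' v) (q v) (q w) (q' w)
  rw [dist_comm (q' w) (q w)] at h4
  rw [dist_comm (q' v) (q v)] at h5
  constructor <;> linarith

theorem comp_neg (h : IsQuasiGeodesicOn K C q s) :
    IsQuasiGeodesicOn K C (fun t => q (-t)) (-s) := by
  refine ⟨h.1, h.2.1, fun v hv w hw hvw => ?_⟩
  have := h.2.2 (-w) hw (-v) hv (by linarith)
  rw [dist_comm, show w - v = -v - -w by ring]
  exact this

end IsQuasiGeodesicOn

theorem Isometry.isQuasiGeodesicOn {α : ℝ → X} (h : Isometry α) (s : Set ℝ) :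
    IsQuasiGeodesicOn 1 0 α s := by
  refine ⟨le_rfl, le_rfl, fun v _ w _ hvw => ?_⟩
  rw [h.dist_eq, Real.dist_eq, abs_sub_comm, abs_of_nonneg (by linarith)]
  constructor <;> linarith

/-- The `+ 1` pays for an infimum that need not be attained. -/
theorem exists_dist_le_of_mem_cthickening {A : Set X} {x : X} {R : ℝ} (hR : 0 ≤ R)
    (h : x ∈ cthickening R A) : ∃ y ∈ A, dist x y ≤ R + 1 := by
  have : x ∈ thickening (R + 1) A := cthickening_subset_thickening' (by linarith) (by linarith) A h
  obtain ⟨y, hy, hxy⟩ := mem_thickening_iff.1 this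
  exact ⟨y, hy, hxy.le⟩

namespace IsMorse

theorem exists_dist_le {A : Set X} {N : MorseGauge} (h : IsMorse N A) {a b : ℝ}
    (hq : IsQuasiGeodesicOn K C q (Icc a b)) (ha : q a ∈ A) (hb : q b ∈ A) {t : ℝ}
    (ht : t ∈ Icc a b) : ∃ x ∈ A, dist (q t) x ≤ N K C + 1 := by
  have hab : a ≤ b := ht.1.trans ht.2
  have hqi : IsQIEmbedding K C (fun u : Icc a b => q u) := by
    refine ⟨hq.1, hq.2.1, fun x y => ⟨?_, ?_⟩⟩
    · have := hq.lower x.2 y.2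
      rw [Subtype.dist_eq, Real.dist_eq, sub_le_iff_le_add, one_div,
        inv_mul_le_iff₀ (by linarith [hq.1])]
      exact this
    · rw [Subtype.dist_eq, Real.dist_eq]
      exact hq.upper x.2 y.2
  exact exists_dist_le_of_mem_cthickening (N K C).2
    (h K C a b hab _ hqi ha hb ⟨⟨t, ht⟩, rfl⟩)

/-- Since `φ` is independent of the set, a gauge produced this way can be fixed before the sets are,
as uniform statements require. -/
theorem of_exists_dist_le {A : Set X} {φ : ℝ → ℝ → ℝ}
    (h : ∀ (K C a b : ℝ) (q : ℝ → X), IsQuasiGeodesicOn K C q (Icc a b) → q a ∈ A → q b ∈ A →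
      ∀ t ∈ Icc a b, ∃ x ∈ A, dist (q t) x ≤ φ K C) :
    IsMorse (fun K C => (φ K C).toNNReal) A := by
  rintro K C a b hab q hq ha hb _ ⟨t, rfl⟩
  have hext : ∀ u (hu : u ∈ Icc a b), IccExtend hab q u = q ⟨u, hu⟩ :=
    fun u hu => IccExtend_of_mem hab q hu
  have hqg : IsQuasiGeodesicOn K C (IccExtend hab q) (Icc a b) := by
    refine ⟨hq.1, hq.2.1, fun v hv w hw hvw => ?_⟩
    have := hq.2.2 ⟨v, hv⟩ ⟨w, hw⟩
    rw [hext v hv, hext w hw]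
    rw [Subtype.dist_eq, Real.dist_eq, abs_sub_comm, abs_of_nonneg (by simpa using hvw)] at this
    rw [div_eq_inv_mul, ← one_div]
    exact this
  obtain ⟨x, hx, hd⟩ := h K C a b _ hqg (by rw [hext a ⟨le_rfl, hab⟩]; exact ha)
    (by rw [hext b ⟨hab, le_rfl⟩]; exact hb) t t.2
  rw [hext t t.2] at hd
  exact mem_cthickening_of_dist_le _ x _ _ hx (hd.trans (Real.le_coe_toNNReal _))

theorem mono {A : Set X} {N N' : MorseGauge} (h : IsMorse N A) (hN : ∀ K C, N K C ≤ N' K C) :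
    IsMorse N' A := fun K C a b hab q hq ha hb =>
  (h K C a b hab q hq ha hb).trans (cthickening_mono (by exact_mod_cast hN K C) A)

/-- Endpoints may lie at bounded distance from the Morse set. -/
theorem exists_dist_le_of_near {A : Set X} {N : MorseGauge} (h : IsMorse N A) {a b D : ℝ}
    (hD : 0 ≤ D) (hq : IsQuasiGeodesicOn K C q (Icc a b)) {x y : X} (hx : x ∈ A) (hy : y ∈ A)
    (ha : dist (q a) x ≤ D) (hb : dist (q b) y ≤ D) {t : ℝ} (ht : t ∈ Icc a b) :
    ∃ z ∈ A, dist (q t) z ≤ N K (C + 2 * D) + 1 + D := by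
  classical
  -- Only the two endpoint values change; the jumps are harmless because quasi-geodesics need not be
  -- continuous.
  have hqt : ∃ q' : ℝ → X, q' a ∈ A ∧ q' b ∈ A ∧ ∀ v, dist (q v) (q' v) ≤ D := by
    refine ⟨fun v => if v = a then x else if v = b then y else q v, by simp [hx], ?_, ?_⟩
    · dsimp only
      split_ifs <;> first | exact hx | exact hy | simp_all
    · intro v
      dsimp only
      split_ifs with h1 h2
      · rw [h1]; exact ha
      · rw [h2]; exact hb
      · simpa using hD
  obtain ⟨q', hqa, hqb, hqq⟩ := hqt
  obtain ⟨z, hz, hzd⟩ := h.exists_dist_le (hq.perturb (fun v _ => hqq v) hD) hqa hqb ht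
  refine ⟨z, hz, ?_⟩
  linarith [dist_triangle (q t) (q' t) z, hqq t]

end IsMorse

/-- A set at bounded Hausdorff distance from a Morse set is Morse. -/
theorem exists_gauge_of_near (X : Type*) [MetricSpace X] (N : MorseGauge) {D : ℝ} (hD : 0 ≤ D) :
    ∃ N' : MorseGauge, ∀ (A B : Set X), IsMorse N A →
      (∀ x ∈ A, ∃ y ∈ B, dist x y ≤ D) → (∀ y ∈ B, ∃ x ∈ A, dist y x ≤ D) → IsMorse N' B := by
  refine ⟨_, fun A B hA hAB hBA => IsMorse.of_exists_dist_le
    (φ := fun K C => N K (C + 2 * D) + 1 + D + D) ?_⟩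
  intro K C a b q hq ha hb t ht
  obtain ⟨x, hx, hxd⟩ := hBA _ ha
  obtain ⟨y, hy, hyd⟩ := hBA _ hb
  obtain ⟨z, hz, hzd⟩ := hA.exists_dist_le_of_near hD hq hx hy hxd hyd ht
  obtain ⟨w, hw, hwd⟩ := hAB z hz
  exact ⟨w, hw, by linarith [dist_triangle (q t) z w]⟩

/-- The image of a Morse set under a quasi-isometry is Morse. -/
theorem exists_gauge_image {X Y : Type*} [MetricSpace X] [MetricSpace Y] {f : X → Y}
    (hf : IsQuasiIsometry f) (N : MorseGauge) :
    ∃ N' : MorseGauge, ∀ A : Set X, IsMorse N A → IsMorse N' (f '' A) := by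
  obtain ⟨K₀, C₀, ⟨hK₀, hC₀, hqi⟩, hdense⟩ := hf
  have hK₀' : 0 < K₀ := by linarith
  have hinv : ∀ y : Y, ∃ x : X, dist y (f x) ≤ C₀ + 1 := by
    intro y
    obtain ⟨_, ⟨x, rfl⟩, hx⟩ := exists_dist_le_of_mem_cthickening (A := range f) (x := y) hC₀
      (by rw [hdense]; trivial)
    exact ⟨x, hx⟩
  choose g hg using hinv
  have hlow : ∀ x x', dist x x' ≤ K₀ * (dist (f x) (f x') + C₀) := fun x x' => by
    have := (hqi x x').1
    rwa [sub_le_iff_le_add, one_div, inv_mul_le_iff₀ hK₀'] at this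
  have hup : ∀ x x', dist (f x) (f x') ≤ K₀ * dist x x' + C₀ := fun x x' => (hqi x x').2
  set D := K₀ * (2 * C₀ + 1) with hDdef
  have hD : 0 ≤ D := by positivity
  refine ⟨_, fun A hA => IsMorse.of_exists_dist_le
    (φ := fun K C => K₀ * (N (K₀ * K) (K₀ * (C + 3 * C₀ + 2) + 2 * D) + 1 + D)
      + C₀ + (C₀ + 1)) ?_⟩
  intro K C a b q hq ha hb t ht
  have hK := hq.1
  have hC := hq.2.1
  -- The quasi-geodesic is pulled back by the coarse inverse `g`, compared with `A`, then pushed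
  -- forward. In the additive constant, `2 * (C₀ + 1)` comes from replacing `q` by `f ∘ g ∘ q` at
  -- two points and one more `C₀` from the lower bound for `f`.
  have hgq : IsQuasiGeodesicOn (K₀ * K) (K₀ * (C + 3 * C₀ + 2)) (fun v => g (q v)) (Icc a b) := by
    refine .of_bounds (by nlinarith) (by positivity) ?_ ?_
    · intro v hv w hw hvw
      have h1 := hq.lower hv hw
      rw [abs_sub_comm, abs_of_nonneg (by linarith)] at h1
      have h2 := dist_triangle4 (q v) (f (g (q v))) (f (g (q w))) (q w)
      have h3 := hup (g (q v)) (g (q w))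
      have h4 := hg (q v)
      have h5 := hg (q w)
      rw [dist_comm] at h5
      have h6 : dist (q v) (q w) + C ≤ K₀ * (dist (g (q v)) (g (q w)) + K₀ * (C + 3 * C₀ + 2)) := by
        have : C + 3 * C₀ + 2 ≤ K₀ * (K₀ * (C + 3 * C₀ + 2)) := by
          have : 0 ≤ C + 3 * C₀ + 2 := by positivity
          have := mul_le_mul_of_nonneg_right (show 1 ≤ K₀ * K₀ by nlinarith) this
          linarith
        linarith
      calc w - v ≤ K * (dist (q v) (q w) + C) := h1
        _ ≤ K * (K₀ * (dist (g (q v)) (g (q w)) + K₀ * (C + 3 * C₀ + 2))) := by gcongr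
        _ = _ := by ring
    · intro v hv w hw hvw
      have h1 := hq.upper hv hw
      rw [abs_sub_comm, abs_of_nonneg (by linarith)] at h1
      have h2 := dist_triangle4 (f (g (q v))) (q v) (q w) (f (g (q w)))
      have h4 := hg (q v)
      have h5 := hg (q w)
      rw [dist_comm] at h4
      calc dist (g (q v)) (g (q w)) ≤ K₀ * (dist (f (g (q v))) (f (g (q w))) + C₀) := hlow _ _
        _ ≤ K₀ * (K * (w - v) + (C + 3 * C₀ + 2)) :=
          mul_le_mul_of_nonneg_left (by linarith) hK₀'.le
        _ = _ := by ring
  obtain ⟨x, hx, hxa⟩ := ha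
  obtain ⟨y, hy, hyb⟩ := hb
  have hend : ∀ x, dist (g (f x)) x ≤ D := fun x => by
    refine (hlow _ _).trans ?_
    rw [hDdef, dist_comm]
    exact mul_le_mul_of_nonneg_left (by linarith [hg (f x)]) hK₀'.le
  obtain ⟨z, hz, hzd⟩ := hA.exists_dist_le_of_near hD hgq hx hy
    (by rw [← hxa]; exact hend x) (by rw [← hyb]; exact hend y) ht
  refine ⟨f z, mem_image_of_mem f hz, ?_⟩
  have h1 := dist_triangle (q t) (f (g (q t))) (f z)
  have h2 := hup (g (q t)) z
  have h3 : K₀ * dist (g (q t)) z ≤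
      K₀ * (N (K₀ * K) (K₀ * (C + 3 * C₀ + 2) + 2 * D) + 1 + D) := by gcongr
  linarith [hg (q t)]

/-- A coarse intermediate value theorem. -/
theorem coarse_intermediate_value {s : ℝ → ℝ} {a b c J : ℝ} (hab : a ≤ b)
    (hs : ∀ v ∈ Icc a b, ∀ w ∈ Icc a b, v ≤ w → w ≤ v + 1 → |s v - s w| ≤ J)
    (ha : s a ≤ c) (hb : c ≤ s b) : ∃ t ∈ Icc a b, |s t - c| ≤ J := by
  set S := {t | t ∈ Icc a b ∧ s t ≤ c} with hS
  have haS : a ∈ S := ⟨⟨le_rfl, hab⟩, ha⟩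
  have hbdd : BddAbove S := ⟨b, fun t ht => ht.1.2⟩
  have hsup : sSup S ≤ b := csSup_le ⟨a, haS⟩ fun t ht => ht.1.2
  -- With `v` within `1 / 2` of the supremum, `v + 1` lies beyond it, so `s` has passed `c` by time
  -- `min b (v + 1)`.
  obtain ⟨v, hv, hvs⟩ := exists_lt_of_lt_csSup ⟨a, haS⟩ (show sSup S - 1 / 2 < sSup S by linarith)
  have hvS := le_csSup hbdd hv
  have hw : ∃ w ∈ Icc a b, v ≤ w ∧ w ≤ v + 1 ∧ c ≤ s w := by
    rcases le_or_gt b (v + 1) with h | h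
    · exact ⟨b, ⟨hab, le_rfl⟩, hv.1.2, h, hb⟩
    · refine ⟨v + 1, ⟨by linarith [hv.1.1], h.le⟩, by linarith, le_rfl, ?_⟩
      by_contra! hc
      have := le_csSup hbdd (show v + 1 ∈ S from ⟨⟨by linarith [hv.1.1], h.le⟩, hc.le⟩)
      linarith
  obtain ⟨w, hw, hvw, hwv, hcw⟩ := hw
  have h := abs_le.1 (hs v hv.1 w hw hvw hwv)
  have hsv : s v ≤ c := hv.2
  exact ⟨v, hv.1, abs_le.2 ⟨by linarith, by linarith⟩⟩

end QuasiGeodesics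

/-! ### Concatenations, subrays and unions of Morse geodesics -/

section Concatenation

variable {X : Type*} [MetricSpace X] {K C : ℝ} {q : ℝ → X}

theorem IsGeodesicSpace.exists_geodesic (hX : IsGeodesicSpace X) (x y : X) :
    ∃ e : ℝ → X, e 0 = x ∧ e (dist x y) = y ∧
      ∀ u ∈ Icc 0 (dist x y), ∀ v ∈ Icc 0 (dist x y), dist (e u) (e v) = |u - v| := by
  obtain ⟨L, γ, hγ, h0, hL⟩ := hX x y
  have hd : dist x y = L := by
    rw [← h0, ← hL, hγ.dist_eq, Subtype.dist_eq, Real.dist_eq]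
    simp
  rw [hd]
  have hext : ∀ u (hu : u ∈ Icc (0 : ℝ) L), IccExtend L.2 γ u = γ ⟨u, hu⟩ :=
    fun u hu => IccExtend_of_mem L.2 γ hu
  refine ⟨IccExtend L.2 γ, ?_, ?_, fun u hu v hv => ?_⟩
  · rw [hext 0 ⟨le_rfl, L.2⟩, h0]
  · rw [hext L ⟨L.2, le_rfl⟩, hL]
  · rw [hext u hu, hext v hv, hγ.dist_eq, Subtype.dist_eq, Real.dist_eq]

/-- A nearest point may fail to exist, as `q` need not be continuous; a slack of `1` is enough. -/
theorem exists_almost_nearest (q : ℝ → X) {s : Set ℝ} (hs : s.Nonempty) (o : X) :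
    ∃ v ∈ s, ∀ w ∈ s, dist o (q v) ≤ dist o (q w) + 1 := by
  have hne : (q '' s).Nonempty := hs.image q
  obtain ⟨_, ⟨v, hv, rfl⟩, hd⟩ := (infDist_lt_iff hne).1
    (show infDist o (q '' s) < infDist o (q '' s) + 1 by linarith)
  refine ⟨v, hv, fun w hw => ?_⟩
  linarith [infDist_le_dist_of_mem (x := o) (mem_image_of_mem q hw)]

/-- Following a quasi-geodesic up to an almost nearest point to `o`, then a geodesic to `o`, is
a quasi-geodesic. -/
theorem IsQuasiGeodesicOn.exists_concat (hX : IsGeodesicSpace X) {a b v : ℝ}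
    (hq : IsQuasiGeodesicOn K C q (Icc a b)) (hv : v ∈ Icc a b) (o : X)
    (hnear : ∀ w ∈ Icc a b, dist o (q v) ≤ dist o (q w) + 1) :
    ∃ q' : ℝ → X, IsQuasiGeodesicOn (3 * K) (C + 2) q' (Icc a (v + dist o (q v))) ∧
      (∀ t ≤ v, q' t = q t) ∧ q' (v + dist o (q v)) = o := by
  obtain ⟨e, he0, he1, he⟩ := hX.exists_geodesic (q v) o
  rw [dist_comm] at he1 he
  have hK := hq.1
  have hC := hq.2.1
  set ℓ := dist o (q v) with hℓ
  have hℓ0 : 0 ≤ ℓ := dist_nonneg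
  have hle : ∀ t ≤ v, (if t ≤ v then q t else e (t - v)) = q t := fun t ht => if_pos ht
  have hgt : ∀ t, v < t → (if t ≤ v then q t else e (t - v)) = e (t - v) :=
    fun t ht => if_neg (not_le.2 ht)
  -- The point `e u` is at distance `ℓ - u` from `o`, and no `q w` is closer to `o` than `ℓ - 1`.
  -- Hence the distance `d` from `q w` to `e u` controls `u`, and then `dist (q w) (q v) ≤ 2 * d +
  -- 1`. The two contributions add up to the factor `3`.
  have hmix : ∀ w ∈ Icc a b, ∀ u ∈ Icc 0 ℓ, u ≤ dist (q w) (e u) + 1 := by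
    intro w hw u hu
    have h1 := hnear w hw
    have h2 := dist_triangle o (e u) (q w)
    have h3 := he ℓ ⟨hℓ0, le_rfl⟩ u hu
    rw [he1, abs_of_nonneg (by linarith [hu.2])] at h3
    rw [dist_comm (e u)] at h2
    linarith
  refine ⟨fun t => if t ≤ v then q t else e (t - v), .of_bounds (by linarith) (by linarith) ?_ ?_,
    hle, ?_⟩
  · intro x hx y hy hxy
    rcases le_or_gt y v with hyv | hyv
    · rw [hle x (hxy.trans hyv), hle y hyv]
      have := hq.lower (v := x) (w := y) ⟨hx.1, by linarith [hv.2]⟩ ⟨hy.1, by linarith [hv.2]⟩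
      rw [abs_sub_comm, abs_of_nonneg (by linarith)] at this
      have hd : 0 ≤ dist (q x) (q y) := dist_nonneg
      nlinarith
    · rcases le_or_gt x v with hxv | hxv
      · rw [hle x hxv, hgt y hyv]
        have hu : y - v ∈ Icc 0 ℓ := ⟨by linarith, by linarith [hy.2]⟩
        have hxI : x ∈ Icc a b := ⟨hx.1, by linarith [hv.2]⟩
        have h1 := hmix x hxI _ hu
        have h2 := hq.lower hxI hv
        rw [abs_sub_comm, abs_of_nonneg (by linarith)] at h2
        have h3 := dist_triangle (q x) (e (y - v)) (q v)
        have h4 := he _ hu 0 ⟨le_rfl, hℓ0⟩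
        rw [he0, sub_zero, abs_of_nonneg hu.1] at h4
        have hd : 0 ≤ dist (q x) (e (y - v)) := dist_nonneg
        have h5 : K * (dist (q x) (q v) + C) ≤ K * (2 * dist (q x) (e (y - v)) + 1 + C) :=
          mul_le_mul_of_nonneg_left (by linarith) (by linarith)
        nlinarith
      · rw [hgt x hxv, hgt y hyv, he _ ⟨by linarith, by linarith [hx.2]⟩ _
          ⟨by linarith, by linarith [hy.2]⟩, abs_sub_comm, abs_of_nonneg (by linarith)]
        nlinarith
  · intro x hx y hy hxy
    rcases le_or_gt y v with hyv | hyv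
    · rw [hle x (hxy.trans hyv), hle y hyv]
      have := hq.upper (v := x) (w := y) ⟨hx.1, by linarith [hv.2]⟩ ⟨hy.1, by linarith [hv.2]⟩
      rw [abs_sub_comm, abs_of_nonneg (by linarith)] at this
      nlinarith
    · rcases le_or_gt x v with hxv | hxv
      · rw [hle x hxv, hgt y hyv]
        have hu : y - v ∈ Icc 0 ℓ := ⟨by linarith, by linarith [hy.2]⟩
        have hxI : x ∈ Icc a b := ⟨hx.1, by linarith [hv.2]⟩
        have h2 := hq.upper hxI hv
        rw [abs_sub_comm, abs_of_nonneg (by linarith)] at h2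
        have h3 := dist_triangle (q x) (q v) (e (y - v))
        have h4 := he 0 ⟨le_rfl, hℓ0⟩ _ hu
        rw [he0, zero_sub, abs_neg, abs_of_nonneg hu.1] at h4
        nlinarith
      · rw [hgt x hxv, hgt y hyv, he _ ⟨by linarith, by linarith [hx.2]⟩ _
          ⟨by linarith, by linarith [hy.2]⟩, abs_sub_comm, abs_of_nonneg (by linarith)]
        nlinarith
  · dsimp only
    rcases hℓ0.eq_or_lt with h | h
    · rw [← h] at he1 ⊢
      rw [add_zero, hle v le_rfl, ← he0, he1]
    · rw [hgt _ (by linarith), add_sub_cancel_left, he1]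

/-- Modifying a quasi-geodesic near its right endpoint so that it ends in a prescribed point. -/
theorem IsQuasiGeodesicOn.exists_extend_right (hX : IsGeodesicSpace X) {a b t H : ℝ}
    (hq : IsQuasiGeodesicOn K C q (Icc a b)) {o : X} (ho : dist o (q b) ≤ H)
    (hat : a ≤ t) (htb : t + K * (2 * H + 1 + C) ≤ b) :
    ∃ (b' : ℝ) (q' : ℝ → X), t ≤ b' ∧ IsQuasiGeodesicOn (3 * K) (C + 2) q' (Icc a b') ∧
      (∀ u ≤ t, q' u = q u) ∧ q' b' = o := by
  have hH : 0 ≤ H := dist_nonneg.trans ho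
  have hK := hq.1
  have hC := hq.2.1
  have htb' : t ≤ b := by nlinarith
  have hbI : b ∈ Icc a b := ⟨by linarith, le_rfl⟩
  obtain ⟨v, hv, hnear⟩ := exists_almost_nearest q (s := Icc a b) ⟨b, hbI⟩ o
  obtain ⟨q', hq', heq, hend⟩ := hq.exists_concat hX hv o hnear
  -- The almost nearest point is within `2 * H + 1` of `q b`, so its parameter is too close to `b`
  -- to precede `t`.
  have hvt : t ≤ v := by
    have h1 := hq.lower hv hbI
    rw [abs_sub_comm, abs_of_nonneg (by linarith [hv.2])] at h1
    have h2 := hnear b hbI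
    have h3 := dist_triangle_left (q v) (q b) o
    have h4 : K * (dist (q v) (q b) + C) ≤ K * (2 * H + 1 + C) :=
      mul_le_mul_of_nonneg_left (by linarith) (by linarith)
    linarith
  exact ⟨_, q', by linarith [dist_nonneg (x := o) (y := q v)], hq',
    fun u hu => heq u (hu.trans hvt), hend⟩

theorem IsQuasiGeodesicOn.exists_extend_left (hX : IsGeodesicSpace X) {a b t H : ℝ}
    (hq : IsQuasiGeodesicOn K C q (Icc a b)) {o : X} (ho : dist o (q a) ≤ H)
    (htb : t ≤ b) (hat : a + K * (2 * H + 1 + C) ≤ t) :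
    ∃ (a' : ℝ) (q' : ℝ → X), a' ≤ t ∧ IsQuasiGeodesicOn (3 * K) (C + 2) q' (Icc a' b) ∧
      (∀ u, t ≤ u → q' u = q u) ∧ q' a' = o := by
  have h := hq.comp_neg
  rw [neg_Icc] at h
  obtain ⟨b', q', hb', hq', heq, hend⟩ := h.exists_extend_right hX (o := o) (t := -t) (H := H)
    (by simpa using ho) (by linarith) (by linarith)
  have h' := hq'.comp_neg
  rw [neg_Icc, neg_neg] at h'
  refine ⟨-b', _, by linarith, h', fun u hu => ?_, by simpa using hend⟩
  simpa using heq (-u) (by linarith)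

/-- A geodesic line whose two ends are near a Morse set is uniformly near it. -/
theorem IsMorse.line_near (hX : IsGeodesicSpace X) {A : Set X} {N : MorseGauge}
    (hA : IsMorse N A) {β : ℝ → X} (hβ : Isometry β) {H : ℝ}
    (hpos : ∀ u ≥ 0, ∃ x ∈ A, dist (β u) x ≤ H) (hneg : ∀ u ≤ 0, ∃ x ∈ A, dist (β u) x ≤ H)
    (t : ℝ) : ∃ x ∈ A, dist (β t) x ≤ N 9 4 + 1 := by
  have hH : 0 ≤ H := by
    obtain ⟨x, -, hx⟩ := hpos 0 le_rfl
    exact dist_nonneg.trans hx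
  -- The ends are taken far enough out that correcting both leaves `β t` untouched. The constants go
  -- from `(1, 0)` to `(3, 2)` to `(9, 4)`; `H` affects only how far out the cuts are, not the final
  -- bound.
  obtain ⟨y, hy, hyd⟩ := hpos (|t| + (2 * H + 1)) (by positivity)
  obtain ⟨x, hx, hxd⟩ := hneg (-(|t| + 3 * (2 * H + 1 + 2))) (by
    have := abs_nonneg t
    linarith)
  rw [dist_comm] at hyd hxd
  have ht := abs_le.1 (le_refl |t|)
  obtain ⟨b', q₁, hb', hq₁, heq₁, hend₁⟩ := (hβ.isQuasiGeodesicOn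
    (Icc (-(|t| + 3 * (2 * H + 1 + 2))) (|t| + (2 * H + 1)))).exists_extend_right hX
      (t := t) hyd (by linarith) (by linarith)
  obtain ⟨a', q₂, ha', hq₂, heq₂, hend₂⟩ := hq₁.exists_extend_left hX (o := x) (t := t) (H := H)
    (by rwa [heq₁ _ (by linarith)]) hb' (by linarith)
  obtain ⟨z, hz, hzd⟩ := hA.exists_dist_le (t := t) hq₂ (by rwa [hend₂])
    (by rwa [heq₂ _ hb', hend₁]) ⟨ha', hb'⟩
  refine ⟨z, hz, ?_⟩
  rw [heq₂ t le_rfl, heq₁ t le_rfl] at hzd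
  norm_num at hzd
  exact hzd

/-- A geodesic ray that starts near a Morse set and whose end is near it is uniformly near it. -/
theorem IsMorse.ray_near (hX : IsGeodesicSpace X) {A : Set X} {N : MorseGauge}
    (hA : IsMorse N A) {β : ℝ → X} (hβ : Isometry β) {H D : ℝ} {x₀ : X} (hx₀ : x₀ ∈ A)
    (hD : dist (β 0) x₀ ≤ D) (hpos : ∀ u ≥ 0, ∃ x ∈ A, dist (β u) x ≤ H) {t : ℝ} (ht : 0 ≤ t) :
    ∃ x ∈ A, dist (β t) x ≤ N 3 (2 + 2 * D) + 1 + D := by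
  have hH : 0 ≤ H := by
    obtain ⟨x, -, hx⟩ := hpos 0 le_rfl
    exact dist_nonneg.trans hx
  have hD0 : 0 ≤ D := dist_nonneg.trans hD
  obtain ⟨y, hy, hyd⟩ := hpos (t + (2 * H + 1)) (by positivity)
  rw [dist_comm] at hyd
  obtain ⟨b', q₁, hb', hq₁, heq₁, hend₁⟩ := (hβ.isQuasiGeodesicOn
    (Icc 0 (t + (2 * H + 1)))).exists_extend_right hX (t := t) hyd ht (by linarith)
  obtain ⟨z, hz, hzd⟩ := hA.exists_dist_le_of_near hD0 (t := t) hq₁ hx₀ hy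
    (by rwa [heq₁ 0 ht]) (by rwa [hend₁, dist_self]) ⟨ht, hb'⟩
  refine ⟨z, hz, ?_⟩
  rw [heq₁ t le_rfl] at hzd
  norm_num at hzd
  exact hzd

theorem Isometry.dist_real {α : ℝ → X} (hα : Isometry α) (u v : ℝ) :
    dist (α u) (α v) = |u - v| := by
  rw [hα.dist_eq, Real.dist_eq]

theorem Isometry.comp_neg_real {α : ℝ → X} (hα : Isometry α) : Isometry (fun t => α (-t)) :=
  hα.comp (IsometryEquiv.neg ℝ).isometry

/-- Two rays with nearby starting points and nearby points are close at equal times. -/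
theorem dist_le_of_rays_near {α β : ℝ → X} (hα : Isometry α) (hβ : Isometry β) {D R s t : ℝ}
    (hD : dist (α 0) (β 0) ≤ D) (hs : 0 ≤ s) (ht : 0 ≤ t) (hR : dist (β t) (α s) ≤ R) :
    dist (α t) (β t) ≤ 2 * R + D := by
  have h1 := hα.dist_real 0 s
  have h2 := hβ.dist_real 0 t
  have h3 := hα.dist_real t s
  rw [zero_sub, abs_neg, abs_of_nonneg hs] at h1
  rw [zero_sub, abs_neg, abs_of_nonneg ht] at h2
  have h4 := dist_triangle4 (α 0) (β 0) (β t) (α s)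
  have h5 := dist_triangle4 (β 0) (α 0) (α s) (β t)
  rw [dist_comm (β 0) (α 0), dist_comm (α s)] at h5
  have h6 : |t - s| ≤ D + R := abs_le.2 ⟨by linarith, by linarith⟩
  have h7 := dist_triangle_right (α t) (β t) (α s)
  linarith

/-- Cutting a Morse geodesic on the right. -/
theorem exists_gauge_inter_Iic (X : Type*) [MetricSpace X] (N : MorseGauge) :
    ∃ N' : MorseGauge, ∀ (α : ℝ → X) (S : Set ℝ) (c : ℝ),
      Isometry α → c ∈ S → IsMorse N (α '' S) → IsMorse N' (α '' (S ∩ Iic c)) := by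
  refine ⟨_, fun α S c hα hc hN => IsMorse.of_exists_dist_le
    (φ := fun K C => (N K C + 1 + (K + C + 2 * (N K C + 1))) +
      (K * (K * (2 * (N K C + 1 + (K + C + 2 * (N K C + 1))) + C)) + C)) ?_⟩
  intro K C a b q hq ha hb t ht
  have hK := hq.1
  have hC := hq.2.1
  set R : ℝ := N K C + 1 with hR
  have hR0 : 0 ≤ R := by positivity
  set J := K + C + 2 * R with hJ
  have hex : ∀ v ∈ Icc a b, ∃ s ∈ S, dist (q v) (α s) ≤ R := by
    intro v hv
    obtain ⟨_, ⟨s, hs, rfl⟩, hd⟩ := hN.exists_dist_le hq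
      (image_mono inter_subset_left ha) (image_mono inter_subset_left hb) hv
    exact ⟨s, hs, hd⟩
  -- The projection parameter is chosen at most `c` whenever possible; this forces `s a ≤ c` and `s
  -- b ≤ c`.
  have hpick : ∀ v : ℝ, ∃ s : ℝ, v ∈ Icc a b → s ∈ S ∧ dist (q v) (α s) ≤ R ∧
      ((∃ s' ∈ S ∩ Iic c, dist (q v) (α s') ≤ R) → s ≤ c) := by
    intro v
    by_cases hv : v ∈ Icc a b
    · by_cases h : ∃ s' ∈ S ∩ Iic c, dist (q v) (α s') ≤ R
      · obtain ⟨s', hs', hd⟩ := h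
        exact ⟨s', fun _ => ⟨hs'.1, hd, fun _ => hs'.2⟩⟩
      · obtain ⟨s, hs, hd⟩ := hex v hv
        exact ⟨s, fun _ => ⟨hs, hd, fun h' => absurd h' h⟩⟩
    · exact ⟨0, fun h => absurd h hv⟩
  choose s hs using hpick
  have hab : a ≤ b := ht.1.trans ht.2
  have haI : a ∈ Icc a b := ⟨le_rfl, hab⟩
  have hbI : b ∈ Icc a b := ⟨hab, le_rfl⟩
  have hsa : s a ≤ c := by
    obtain ⟨s', hs', h⟩ := ha
    exact (hs a haI).2.2 ⟨s', hs', by rw [h, dist_self]; exact hR0⟩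
  have hsb : s b ≤ c := by
    obtain ⟨s', hs', h⟩ := hb
    exact (hs b hbI).2.2 ⟨s', hs', by rw [h, dist_self]; exact hR0⟩
  have hjump : ∀ v ∈ Icc a b, ∀ w ∈ Icc a b, v ≤ w → w ≤ v + 1 → |s v - s w| ≤ J := by
    intro v hv w hw hvw hwv
    have h1 := hq.upper hv hw
    rw [abs_sub_comm, abs_of_nonneg (by linarith)] at h1
    have h2 := dist_triangle4 (α (s v)) (q v) (q w) (α (s w))
    rw [dist_comm (α (s v)) (q v), hα.dist_real] at h2
    have h3 : K * (w - v) ≤ K * 1 := mul_le_mul_of_nonneg_left (by linarith) (by linarith)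
    linarith [(hs v hv).2.1, (hs w hw).2.1]
  rcases le_or_gt (s t) c with hst | hst
  · refine ⟨α (s t), ⟨s t, ⟨(hs t ht).1, hst⟩, rfl⟩, (hs t ht).2.1.trans ?_⟩
    have : 0 ≤ K * (K * (2 * (R + J) + C)) := by positivity
    have : 0 ≤ J := by positivity
    linarith
  -- If the projection overshoots at `t`, it crosses `c` before and after `t`. Then `q u` and `q w`
  -- are both near `α c`, so `[u, w]` is short and `q t` is near `α c` too.
  obtain ⟨u, hu, hu'⟩ := coarse_intermediate_value (s := s) (c := c) (J := J) ht.1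
    (fun v hv w hw => hjump v ⟨hv.1, hv.2.trans ht.2⟩ w ⟨hw.1, hw.2.trans ht.2⟩) hsa hst.le
  obtain ⟨w, hw, hw'⟩ := coarse_intermediate_value (s := fun v => -s v) (c := -c) (J := J) ht.2
    (fun v hv w hw h1 h2 => by
      rw [neg_sub_neg, abs_sub_comm]
      exact hjump v ⟨ht.1.trans hv.1, hv.2⟩ w ⟨ht.1.trans hw.1, hw.2⟩ h1 h2)
    (by linarith) (by linarith)
  rw [neg_sub_neg, abs_sub_comm] at hw'
  have huI : u ∈ Icc a b := ⟨hu.1, hu.2.trans ht.2⟩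
  have hwI : w ∈ Icc a b := ⟨ht.1.trans hw.1, hw.2⟩
  have h1 : dist (q u) (α c) ≤ R + J := by
    have := dist_triangle (q u) (α (s u)) (α c)
    rw [hα.dist_real] at this
    linarith [(hs u huI).2.1]
  have h2 : dist (q w) (α c) ≤ R + J := by
    have := dist_triangle (q w) (α (s w)) (α c)
    rw [hα.dist_real] at this
    linarith [(hs w hwI).2.1]
  have h3 := hq.lower huI hwI
  rw [abs_sub_comm, abs_of_nonneg (by linarith [hu.2, hw.1])] at h3
  have h4 := hq.upper huI ht
  rw [abs_sub_comm, abs_of_nonneg (by linarith [hu.2])] at h4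
  have h5 := dist_triangle_right (q u) (q w) (α c)
  have h6 : K * (dist (q u) (q w) + C) ≤ K * (2 * (R + J) + C) :=
    mul_le_mul_of_nonneg_left (by linarith) (by linarith)
  have h7 : K * (t - u) ≤ K * (K * (2 * (R + J) + C)) :=
    mul_le_mul_of_nonneg_left (by linarith [hw.1]) (by linarith)
  refine ⟨α c, ⟨c, ⟨hc, le_refl c⟩, rfl⟩, ?_⟩
  have h8 := dist_triangle_left (q t) (α c) (q u)
  linarith

/-- A half is one cut, up to reversal, and a segment is a second cut of a half; this is why the
cutting lemma allows an arbitrary parameter set. -/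
theorem exists_gauge_halves (X : Type*) [MetricSpace X] (N : MorseGauge) :
    ∃ N' : MorseGauge, ∀ (α : ℝ → X), Isometry α →
      IsMorse N (range α) → IsMorse N' (α '' Ici 0) ∧ IsMorse N' ((fun t => α (-t)) '' Ici 0) ∧
        ∀ T : ℝ, 0 ≤ T → IsMorse N' (α '' Icc 0 T) := by
  obtain ⟨N₁, h₁⟩ := exists_gauge_inter_Iic X N
  obtain ⟨N₂, h₂⟩ := exists_gauge_inter_Iic X N₁
  have key : ∀ α : ℝ → X, Isometry α →
      IsMorse N (range α) → IsMorse N₁ (α '' Ici 0) := by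
    intro α hα hN
    have h := h₁ (fun t => α (-t)) univ 0 hα.comp_neg_real trivial (by
      rw [image_univ]
      convert hN using 1
      exact (neg_surjective (G := ℝ)).range_comp α)
    convert h using 1
    ext x
    simp only [univ_inter, mem_image, mem_Ici, mem_Iic]
    constructor
    · rintro ⟨t, ht, rfl⟩
      exact ⟨-t, by linarith, by simp⟩
    · rintro ⟨t, ht, rfl⟩
      exact ⟨-t, by linarith, rfl⟩
  refine ⟨fun K C => max (N₁ K C) (N₂ K C), fun α hα hN => ⟨?_, ?_, fun T hT => ?_⟩⟩
  · exact (key α hα hN).mono fun K C => le_max_left _ _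
  · refine (key _ hα.comp_neg_real ?_).mono fun K C => le_max_left _ _
    convert hN using 1
    exact (neg_surjective (G := ℝ)).range_comp α
  · have := h₂ α (Ici 0) T hα hT (key α hα hN)
    rw [Ici_inter_Iic] at this
    exact this.mono fun K C => le_max_right _ _

/-- A ray which leaves the neighbourhood of a Morse ray diverges from it linearly. -/
theorem IsMorse.add_le_of_diverge (hX : IsGeodesicSpace X) {N : MorseGauge} {α β : ℝ → X}
    (hα : Isometry α) (hβ : Isometry β) (hN : IsMorse N (β '' Ici 0)) {D T : ℝ}
    (hD : dist (α 0) (β 0) ≤ D)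
    (hT : ∀ u ≥ 0, N 3 (2 + 2 * D) + 1 + D < dist (α T) (β u)) (hT0 : 0 ≤ T) {s t : ℝ}
    (hs : 0 ≤ s) (ht : 0 ≤ t) : s + t ≤ 3 * dist (α s) (β t) + (2 + 2 * T + D) := by
  have hD0 : 0 ≤ D := dist_nonneg.trans hD
  obtain ⟨v, hv, hnear⟩ := exists_almost_nearest α (s := Icc 0 s) ⟨0, le_rfl, hs⟩ (β t)
  obtain ⟨q, hq, heq, hend⟩ := (hα.isQuasiGeodesicOn (Icc 0 s)).exists_concat hX hv (β t) hnear
  -- Otherwise the concatenated path would pass through `α T`, while its ends are near the Morse ray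
  -- `β`; this contradicts `hT`. So `β t` projects to the initial part of `α`, and triangle
  -- inequalities give the linear bound.
  have hvT : v < T := by
    by_contra! h
    obtain ⟨_, ⟨u, hu, rfl⟩, hd⟩ := hN.exists_dist_le_of_near hD0 (t := T) hq
      (mem_image_of_mem β (show (0 : ℝ) ∈ Ici 0 from le_refl (0 : ℝ)))
      (mem_image_of_mem β (show t ∈ Ici 0 from ht))
      (by rwa [heq 0 hv.1]) (by rwa [hend, dist_self])
      ⟨hT0, by linarith [dist_nonneg (x := β t) (y := α v)]⟩
    rw [heq T h] at hd
    norm_num at hd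
    exact absurd hd (not_le.2 (hT u hu))
  have h1 := hnear s ⟨hs, le_rfl⟩
  have h2 := dist_triangle (α s) (β t) (α v)
  have h3 := dist_triangle4 (β 0) (α 0) (α v) (β t)
  rw [hα.dist_real, abs_of_nonneg (by linarith [hv.2])] at h2
  rw [hα.dist_real, hβ.dist_real, dist_comm (β 0), dist_comm (α v), zero_sub, zero_sub, abs_neg,
    abs_neg, abs_of_nonneg ht, abs_of_nonneg hv.1] at h3
  rw [dist_comm (β t) (α s)] at h1
  linarith

/-- The bi-infinite path which runs backwards through `α` and then forwards through `β`. -/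
noncomputable def joinRays {X : Type*} (α β : ℝ → X) (t : ℝ) : X := if 0 ≤ t then β t else α (-t)

theorem joinRays_of_nonneg {X : Type*} (α β : ℝ → X) {t : ℝ} (ht : 0 ≤ t) : joinRays α β t = β t := if_pos ht

theorem joinRays_of_neg {X : Type*} (α β : ℝ → X) {t : ℝ} (ht : t < 0) : joinRays α β t = α (-t) :=
  if_neg (not_le.2 ht)

theorem isQuasiGeodesicOn_joinRays {α β : ℝ → X} (hα : Isometry α) (hβ : Isometry β) {D c : ℝ}
    (hD : dist (α 0) (β 0) ≤ D) (hDc : D ≤ c)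
    (h : ∀ s ≥ 0, ∀ t ≥ 0, s + t ≤ 3 * dist (α s) (β t) + c) :
    IsQuasiGeodesicOn 3 c (joinRays α β) univ := by
  have hD0 : 0 ≤ D := dist_nonneg.trans hD
  have main : ∀ v w : ℝ, v ≤ w → w - v ≤ 3 * (dist (joinRays α β v) (joinRays α β w) + c) ∧
      dist (joinRays α β v) (joinRays α β w) ≤ 3 * (w - v) + c := by
    intro v w hvw
    rcases le_or_gt 0 v with hv | hv
    · rw [joinRays_of_nonneg _ _ hv, joinRays_of_nonneg _ _ (hv.trans hvw), hβ.dist_real,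
        abs_sub_comm, abs_of_nonneg (by linarith)]
      constructor <;> linarith
    · rcases le_or_gt 0 w with hw | hw
      · rw [joinRays_of_neg _ _ hv, joinRays_of_nonneg _ _ hw]
        have h1 := h (-v) (by linarith) w hw
        have h2 := dist_triangle4 (α (-v)) (α 0) (β 0) (β w)
        rw [hα.dist_real, hβ.dist_real, sub_zero, zero_sub, abs_neg w,
          abs_of_nonneg (show 0 ≤ -v by linarith), abs_of_nonneg hw] at h2
        constructor <;> linarith
      · rw [joinRays_of_neg _ _ hv, joinRays_of_neg _ _ hw, hα.dist_real,
          abs_of_nonneg (by linarith)]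
        constructor <;> linarith
  exact .of_bounds (by norm_num) (by linarith) (fun v _ w _ hvw => (main v w hvw).1)
    fun v _ w _ hvw => (main v w hvw).2

/-- The right end of `q` may be far from `A`. Redirecting `q` to `o` at its almost nearest point
gives a quasi-geodesic with both ends near `A`, unchanged up to `v`. -/
theorem IsMorse.near_of_le_nearest (hX : IsGeodesicSpace X) {A : Set X} {N : MorseGauge}
    (hA : IsMorse N A) {a b v D : ℝ} (hq : IsQuasiGeodesicOn K C q (Icc a b)) (hv : v ∈ Icc a b)
    {o x : X} (hnear : ∀ w ∈ Icc a b, dist o (q v) ≤ dist o (q w) + 1) (hx : x ∈ A)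
    (hox : dist o x ≤ D) (ha : q a ∈ A) {t : ℝ} (hat : a ≤ t) (htv : t ≤ v) :
    ∃ y ∈ A, dist (q t) y ≤ N (3 * K) (C + 2 + 2 * D) + 1 + D := by
  have hD : 0 ≤ D := dist_nonneg.trans hox
  obtain ⟨q', hq', heq, hend⟩ := hq.exists_concat hX hv o hnear
  have := hA.exists_dist_le_of_near hD hq' (t := t) ha hx (by rwa [heq a hv.1, dist_self])
    (by rwa [hend]) ⟨hat, by linarith [dist_nonneg (x := o) (y := q v)]⟩
  rwa [heq t htv] at this

/-- The union of two Morse sets which nearly meet is Morse. -/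
theorem exists_gauge_union (hX : IsGeodesicSpace X) (N : MorseGauge) (D : ℝ) :
    ∃ N' : MorseGauge, ∀ (A B : Set X) (x y : X), IsMorse N A → IsMorse N B → x ∈ A → y ∈ B →
      dist x y ≤ D → IsMorse N' (A ∪ B) := by
  refine ⟨_, fun A B x y hA hB hx hy hxy => IsMorse.of_exists_dist_le
    (φ := fun K C => N (3 * K) (C + 2 + 2 * D) + 1 + D) ?_⟩
  have hD : 0 ≤ D := dist_nonneg.trans hxy
  have main : ∀ (K C a b v : ℝ) (q : ℝ → X), IsQuasiGeodesicOn K C q (Icc a b) → v ∈ Icc a b →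
      (∀ w ∈ Icc a b, dist x (q v) ≤ dist x (q w) + 1) → q a ∈ A ∪ B → ∀ t, a ≤ t → t ≤ v →
      ∃ z ∈ A ∪ B, dist (q t) z ≤ N (3 * K) (C + 2 + 2 * D) + 1 + D := by
    intro K C a b v q hq hv hnear ha t hat htv
    rcases ha with ha | ha
    · obtain ⟨z, hz, h⟩ := hA.near_of_le_nearest hX hq hv hnear hx
        (by rwa [dist_self] : dist x x ≤ D) ha hat htv
      exact ⟨z, Or.inl hz, h⟩
    · obtain ⟨z, hz, h⟩ := hB.near_of_le_nearest hX hq hv hnear hy hxy ha hat htv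
      exact ⟨z, Or.inr hz, h⟩
  intro K C a b q hq ha hb t ht
  -- Splitting at the point almost nearest to the junction lets each half of `q` be compared with
  -- just one of the two sets, the one containing its outer end.
  obtain ⟨v, hv, hnear⟩ := exists_almost_nearest q (s := Icc a b) ⟨t, ht⟩ x
  rcases le_total t v with htv | hvt
  · exact main K C a b v q hq hv hnear ha t ht.1 htv
  · have hq' := hq.comp_neg
    rw [neg_Icc] at hq'
    have := main K C (-b) (-a) (-v) _ hq' ⟨by linarith [hv.2], by linarith [hv.1]⟩
      (fun w hw => by simpa using hnear (-w) ⟨by linarith [hw.2], by linarith [hw.1]⟩)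
      (by simpa using hb) (-t) (by linarith [ht.2]) (by linarith)
    simpa using this

end Concatenation

/-- The half-lines `α '' [0, ∞)` and `β '' [0, ∞)` lie within `H` of each other. -/
def RaysNear {X : Type*} [MetricSpace X] (H : ℝ) (α β : ℝ → X) : Prop :=
  (∀ u ≥ 0, ∃ s ≥ 0, dist (α u) (β s) ≤ H) ∧ ∀ s ≥ 0, ∃ u ≥ 0, dist (β s) (α u) ≤ H

/-! ### Straightening Morse quasi-geodesic lines -/

section Lines

variable {X : Type*} [MetricSpace X] {K C : ℝ} {q : ℝ → X}

namespace RaysNear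

variable {α β γ : ℝ → X} {H H' : ℝ}

theorem symm (h : RaysNear H α β) : RaysNear H β α := ⟨h.2, h.1⟩

theorem trans (h : RaysNear H α β) (h' : RaysNear H' β γ) : RaysNear (H + H') α γ := by
  constructor
  · intro u hu
    obtain ⟨s, hs, hd⟩ := h.1 u hu
    obtain ⟨t, ht, hd'⟩ := h'.1 s hs
    exact ⟨t, ht, by linarith [dist_triangle (α u) (β s) (γ t)]⟩
  · intro u hu
    obtain ⟨s, hs, hd⟩ := h'.2 u hu
    obtain ⟨t, ht, hd'⟩ := h.2 s hs
    exact ⟨t, ht, by linarith [dist_triangle (γ u) (β s) (α t)]⟩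

theorem of_dist_le (h : ∀ u ≥ 0, dist (α u) (β u) ≤ H) : RaysNear H α β :=
  ⟨fun u hu => ⟨u, hu, h u hu⟩, fun u hu => ⟨u, hu, by rw [dist_comm]; exact h u hu⟩⟩

end RaysNear

/-- This bounds the jumps of projection parameters, as the coarse intermediate value theorem
requires. -/
theorem IsQuasiGeodesicOn.abs_sub_le_of_near (hq : IsQuasiGeodesicOn K C q univ) {x y : X}
    {R s t : ℝ} (hxy : dist x y ≤ 1) (hx : dist x (q s) ≤ R) (hy : dist y (q t) ≤ R) :
    |s - t| ≤ K * (2 * R + 1 + C) := by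
  refine (hq.lower (mem_univ _) (mem_univ _)).trans ?_
  refine mul_le_mul_of_nonneg_left ?_ (by linarith [hq.1])
  have h1 := dist_triangle4 (q s) x y (q t)
  rw [dist_comm (q s) x] at h1
  linarith

/-- If the projection of `e u` falls on the negative half of `q`, it must return near `q 0` at some
later time `w`, because `s ℓ ≥ 0`. Both `e u₀` and `e w` are then near `q 0`, so the geodesic piece
between them, which contains `e u`, is short. -/
theorem near_nonneg_of_geodesic {e : ℝ → X} {s : ℝ → ℝ} {u₀ ℓ R J : ℝ}
    (hq : IsQuasiGeodesicOn K C q univ) (hR : 0 ≤ R) (hJ : J = K * (2 * R + 1 + C))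
    (he : ∀ u ∈ Icc u₀ ℓ, ∀ v ∈ Icc u₀ ℓ, dist (e u) (e v) = |u - v|)
    (hs : ∀ u ∈ Icc u₀ ℓ, dist (e u) (q (s u)) ≤ R) (h0 : |s u₀| ≤ J) (hℓ : 0 ≤ s ℓ) {u : ℝ}
    (hu : u ∈ Icc u₀ ℓ) :
    ∃ t ≥ 0, dist (e u) (q t) ≤ R + (2 * R + K * (2 * J) + C) + (R + K * J + C) := by
  have hK := hq.1
  have hC := hq.2.1
  have hJ0 : 0 ≤ J := (abs_nonneg _).trans h0
  rcases le_or_gt 0 (s u) with hsu | hsu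
  · refine ⟨s u, hsu, (hs u hu).trans ?_⟩
    have : 0 ≤ K * (2 * J) := by positivity
    have : 0 ≤ K * J := by positivity
    linarith
  · have hu₀ : u₀ ∈ Icc u₀ ℓ := ⟨le_rfl, hu.1.trans hu.2⟩
    obtain ⟨w, hw, hsw⟩ := coarse_intermediate_value (s := s) (c := 0) (J := J) hu.2 (by
      intro v hv w hw hvw hwv
      have hv' : v ∈ Icc u₀ ℓ := ⟨hu.1.trans hv.1, hv.2⟩
      have hw' : w ∈ Icc u₀ ℓ := ⟨hu.1.trans hw.1, hw.2⟩
      rw [hJ]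
      refine hq.abs_sub_le_of_near ?_ (hs v hv') (hs w hw')
      rw [he v hv' w hw', abs_sub_comm, abs_of_nonneg (by linarith)]
      linarith) hsu.le hℓ
    have hw' : w ∈ Icc u₀ ℓ := ⟨hu.1.trans hw.1, hw.2⟩
    rw [sub_zero] at hsw
    have h1 : dist (q (s w)) (q (s u₀)) ≤ K * (2 * J) + C := by
      refine (hq.upper (mem_univ _) (mem_univ _)).trans ?_
      have : |s w - s u₀| ≤ 2 * J := by linarith [abs_sub (s w) (s u₀)]
      gcongr
    have h2 : w - u₀ ≤ 2 * R + K * (2 * J) + C := by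
      have h3 := dist_triangle4 (e w) (q (s w)) (q (s u₀)) (e u₀)
      rw [he w hw' u₀ hu₀, abs_of_nonneg (by linarith [hw'.1]), dist_comm (q (s u₀)) (e u₀)] at h3
      linarith [hs w hw', hs u₀ hu₀]
    have h3 : dist (q (s u₀)) (q 0) ≤ K * J + C := by
      refine (hq.upper (mem_univ _) (mem_univ _)).trans ?_
      rw [sub_zero]
      gcongr
    have h4 := dist_triangle4 (e u) (e u₀) (q (s u₀)) (q 0)
    rw [he u hu u₀ hu₀, abs_of_nonneg (by linarith [hu.1])] at h4
    exact ⟨0, le_rfl, by linarith [hs u₀ hu₀, hw.1]⟩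

/-- A geodesic between far points `q (-m)` and `q m` stays near `q` by the Morse property, and its
projection must cross `0`. It is reparametrised from such a crossing, with each half kept near the
matching half of `q` so that the limit has the right ends. -/
theorem exists_long_geodesic_near (hX : IsGeodesicSpace X) (K C : ℝ) (N : MorseGauge) :
    ∃ R : ℝ, 0 ≤ R ∧ ∀ q : ℝ → X, IsQuasiGeodesicOn K C q univ → IsMorse N (range q) →
      ∀ n : ℕ, ∃ γ : ℝ → X,
        (∀ u ∈ Icc (-n : ℝ) n, ∀ v ∈ Icc (-n : ℝ) n, dist (γ u) (γ v) = |u - v|) ∧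
        dist (γ 0) (q 0) ≤ R ∧ (∀ u ∈ Icc (0 : ℝ) n, ∃ t ≥ 0, dist (γ u) (q t) ≤ R) ∧
        ∀ u ∈ Icc (-n : ℝ) 0, ∃ t ≤ 0, dist (γ u) (q t) ≤ R := by
  by_cases hKC : 1 ≤ K ∧ 0 ≤ C
  swap
  · exact ⟨0, le_rfl, fun q hq => absurd ⟨hq.1, hq.2.1⟩ hKC⟩
  obtain ⟨hK, hC⟩ := hKC
  have hK0 : 0 < K := by linarith
  set R : ℝ := N 1 0 + 1 with hR
  have hR0 : 0 ≤ R := by positivity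
  set J := K * (2 * R + 1 + C) with hJ
  have hJ0 : 0 ≤ J := by positivity
  have hKJ : 0 ≤ K * J := by positivity
  set R₁ := R + (2 * R + K * (2 * J) + C) + (R + K * J + C) with hR₁
  have hR₁0 : 0 ≤ R₁ := by positivity
  refine ⟨R₁, hR₁0, fun q hq hN n => ?_⟩
  set R₀ := R + K * J + C with hR₀
  -- The lower quasi-geodesic bound then puts `q (-m)` and `q m` at distance at least `n` from the
  -- crossing point `e u₀`.
  set m := K * (n + C + R₀) with hm
  have hm0 : 0 ≤ m := by positivity
  have hmR : K * (R + C) ≤ m := mul_le_mul_of_nonneg_left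
    (by have : (0 : ℝ) ≤ n := n.cast_nonneg
        linarith) hK0.le
  obtain ⟨e, he0, he1, he⟩ := hX.exists_geodesic (q (-m)) (q m)
  set ℓ := dist (q (-m)) (q m) with hℓ
  have hℓ0 : 0 ≤ ℓ := dist_nonneg
  have heq : IsQuasiGeodesicOn 1 0 e (Icc 0 ℓ) := by
    refine .of_bounds le_rfl le_rfl ?_ ?_ <;> intro v hv w hw hvw <;>
      rw [he v hv w hw, abs_sub_comm, abs_of_nonneg (by linarith)] <;> linarith
  have hpick : ∀ u : ℝ, ∃ s : ℝ, u ∈ Icc 0 ℓ → dist (e u) (q s) ≤ R := by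
    intro u
    by_cases hu : u ∈ Icc 0 ℓ
    · obtain ⟨_, ⟨s, rfl⟩, hs⟩ := hN.exists_dist_le heq (by rw [he0]; exact mem_range_self _)
        (by rw [he1]; exact mem_range_self _) hu
      exact ⟨s, fun _ => hs⟩
    · exact ⟨0, fun h => absurd h hu⟩
  choose s hs using hpick
  have h0I : (0 : ℝ) ∈ Icc 0 ℓ := ⟨le_rfl, hℓ0⟩
  have hℓI : ℓ ∈ Icc 0 ℓ := ⟨hℓ0, le_rfl⟩
  have hs0 : s 0 ≤ 0 := by
    have h1 := hs 0 h0I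
    rw [he0] at h1
    have h2 := abs_le.1 (hq.lower (mem_univ (-m)) (mem_univ (s 0)))
    have h3 : K * (dist (q (-m)) (q (s 0)) + C) ≤ K * (R + C) := by gcongr
    linarith
  have hsℓ : 0 ≤ s ℓ := by
    have h1 := hs ℓ hℓI
    rw [he1] at h1
    have h2 := abs_le.1 (hq.lower (mem_univ m) (mem_univ (s ℓ)))
    have h3 : K * (dist (q m) (q (s ℓ)) + C) ≤ K * (R + C) := by gcongr
    linarith
  obtain ⟨u₀, hu₀, hsu₀⟩ := coarse_intermediate_value (s := s) (c := 0) (J := J) hℓ0 (by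
    intro v hv w hw hvw hwv
    refine hq.abs_sub_le_of_near ?_ (hs v hv) (hs w hw)
    rw [he v hv w hw, abs_sub_comm, abs_of_nonneg (by linarith)]
    linarith) hs0 hsℓ
  rw [sub_zero] at hsu₀
  have hnear0 : dist (e u₀) (q 0) ≤ R₀ := by
    have h1 := hq.upper (mem_univ (s u₀)) (mem_univ 0)
    rw [sub_zero] at h1
    have h2 : K * |s u₀| ≤ K * J := by gcongr
    linarith [dist_triangle (e u₀) (q (s u₀)) (q 0), hs u₀ hu₀]
  have hlen : ∀ t, |t| = m → (n : ℝ) ≤ dist (q t) (e u₀) := by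
    intro t ht
    have h1 := hq.lower (mem_univ t) (mem_univ 0)
    rw [sub_zero, ht, hm] at h1
    have h2 := le_of_mul_le_mul_left h1 hK0
    linarith [dist_triangle (q t) (e u₀) (q 0)]
  have hnl : (n : ℝ) ≤ u₀ := by
    have h1 := hlen (-m) (by rw [abs_neg, abs_of_nonneg hm0])
    rw [← he0, he 0 h0I u₀ hu₀, zero_sub, abs_neg, abs_of_nonneg hu₀.1] at h1
    exact h1
  have hnr : (n : ℝ) ≤ ℓ - u₀ := by
    have h1 := hlen m (abs_of_nonneg hm0)
    rw [← he1, he ℓ hℓI u₀ hu₀, abs_of_nonneg (by linarith [hu₀.2])] at h1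
    exact h1
  have hn0 : (0 : ℝ) ≤ n := n.cast_nonneg
  refine ⟨fun u => e (u₀ + u), fun u hu v hv => ?_, ?_, fun u hu => ?_, fun u hu => ?_⟩
  · rw [he _ ⟨by linarith [hu.1], by linarith [hu.2]⟩ _ ⟨by linarith [hv.1], by linarith [hv.2]⟩]
    congr 1
    ring
  · dsimp only
    rw [add_zero]
    have : 0 ≤ K * (2 * J) := by positivity
    linarith
  · exact near_nonneg_of_geodesic hq hR0 hJ
      (fun v hv w hw => he v ⟨hu₀.1.trans hv.1, hv.2⟩ w ⟨hu₀.1.trans hw.1, hw.2⟩)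
      (fun v hv => hs v ⟨hu₀.1.trans hv.1, hv.2⟩) hsu₀ hsℓ
      (u := u₀ + u) ⟨by linarith [hu.1], by linarith [hu.2]⟩
  · have hq' := hq.comp_neg
    rw [neg_univ] at hq'
    have hI : ∀ v ∈ Icc (-u₀) 0, -v ∈ Icc 0 ℓ :=
      fun v hv => ⟨by linarith [hv.2], by linarith [hv.1, hu₀.2]⟩
    obtain ⟨t, ht, hd⟩ := near_nonneg_of_geodesic (e := fun v => e (-v)) (s := fun v => -s (-v))
      (u₀ := -u₀) (ℓ := 0) hq' hR0 hJ
      (fun v hv w hw => by rw [he _ (hI v hv) _ (hI w hw), neg_sub_neg, abs_sub_comm])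
      (fun v hv => by simpa using hs _ (hI v hv)) (by simpa using hsu₀) (by simpa using hs0)
      (u := -(u₀ + u)) ⟨by linarith [hu.2], by linarith [hu.1]⟩
    rw [neg_neg] at hd
    exact ⟨-t, by linarith, hd⟩

/-- In a proper space, longer and longer geodesics through a bounded set subconverge to a line. -/
theorem exists_line_of_long_geodesics [ProperSpace X] (x₀ : X) (R : ℝ) (P : ℝ → Set X)
    (hP : ∀ u, IsClosed (P u))
    (h : ∀ n : ℕ, ∃ γ : ℝ → X,
      (∀ u ∈ Icc (-n : ℝ) n, ∀ v ∈ Icc (-n : ℝ) n, dist (γ u) (γ v) = |u - v|) ∧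
      dist (γ 0) x₀ ≤ R ∧ ∀ u ∈ Icc (-n : ℝ) n, γ u ∈ P u) :
    ∃ g : ℝ → X, Isometry g ∧ dist (g 0) x₀ ≤ R ∧ ∀ u, g u ∈ P u := by
  choose γ hγ hγ0 hγP using h
  -- A single nonprincipal ultrafilter gives all pointwise limits at once, in place of a diagonal
  -- subsequence.
  have hev : ∀ u : ℝ, ∀ᶠ n : ℕ in (Filter.hyperfilter ℕ : Filter ℕ), u ∈ Icc (-n : ℝ) n := by
    intro u
    refine Nat.hyperfilter_le_atTop ?_
    filter_upwards [Filter.eventually_ge_atTop ⌈|u|⌉₊] with n hn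
    exact abs_le.1 ((Nat.le_ceil _).trans (by exact_mod_cast hn))
  have hlim : ∀ u : ℝ, ∃ x : X, Filter.Tendsto (fun n => γ n u)
      (Filter.hyperfilter ℕ : Filter ℕ) (nhds x) := by
    intro u
    obtain ⟨x, -, hx⟩ := (isCompact_closedBall x₀ (|u| + R)).ultrafilter_le_nhds
      ((Filter.hyperfilter ℕ).map fun n => γ n u) (by
        rw [Ultrafilter.coe_map, Filter.le_principal_iff, Filter.mem_map]
        filter_upwards [hev u] with n hn
        rw [mem_preimage, mem_closedBall]
        have h1 := hγ n u hn 0 ⟨by simp, by simp⟩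
        rw [sub_zero] at h1
        linarith [dist_triangle (γ n u) (γ n 0) x₀, hγ0 n])
    exact ⟨x, hx⟩
  choose g hg using hlim
  refine ⟨g, Isometry.of_dist_eq fun u v => ?_, ?_, fun u => ?_⟩
  · refine tendsto_nhds_unique ((hg u).dist (hg v)) (tendsto_const_nhds.congr' ?_)
    filter_upwards [hev u, hev v] with n hu hv
    rw [hγ n u hu v hv, Real.dist_eq]
  · exact le_of_tendsto ((hg 0).dist tendsto_const_nhds) (Filter.Eventually.of_forall hγ0)
  · refine (hP u).mem_of_tendsto (hg u) ?_
    filter_upwards [hev u] with n hu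
    exact hγP n u hu

/-- The reverse inclusion holds because the projection parameters start near `0`, tend to infinity
and jump boundedly, so no `q t` is skipped. -/
theorem raysNear_of_quasiGeodesic {g : ℝ → X} {R : ℝ} (hg : Isometry g)
    (hq : IsQuasiGeodesicOn K C q univ) (h0 : dist (g 0) (q 0) ≤ R)
    (h : ∀ u ≥ 0, ∃ s ≥ 0, dist (g u) (q s) ≤ R) :
    RaysNear (K * (K * (2 * R + 1 + C)) + C + R) g q := by
  have hK := hq.1
  have hC := hq.2.1
  have hR : 0 ≤ R := dist_nonneg.trans h0
  set J := K * (2 * R + 1 + C) with hJ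
  have hJ0 : 0 ≤ J := by positivity
  have hKJ : 0 ≤ K * J := by positivity
  have hpick : ∀ u : ℝ, ∃ s : ℝ, 0 ≤ u → 0 ≤ s ∧ dist (g u) (q s) ≤ R := by
    intro u
    by_cases hu : 0 ≤ u
    · obtain ⟨s, hs, hd⟩ := h u hu
      exact ⟨s, fun _ => ⟨hs, hd⟩⟩
    · exact ⟨0, fun h => absurd h hu⟩
  choose s hs using hpick
  have hclose : ∀ t x : ℝ, |x - t| ≤ J → dist (q t) (q x) ≤ K * J + C := by
    intro t x hx
    refine (hq.upper (mem_univ _) (mem_univ _)).trans ?_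
    rw [abs_sub_comm]
    gcongr
  refine ⟨fun u hu => ⟨s u, (hs u hu).1, (hs u hu).2.trans (by linarith)⟩, fun t ht => ?_⟩
  rcases le_or_gt t (s 0) with h1 | h1
  · refine ⟨0, le_rfl, ?_⟩
    have h2 := hq.lower (mem_univ (s 0)) (mem_univ 0)
    rw [sub_zero, abs_of_nonneg (hs 0 le_rfl).1] at h2
    have h3 := dist_triangle_left (q (s 0)) (q 0) (g 0)
    have h4 : K * (dist (q (s 0)) (q 0) + C) ≤ J :=
      mul_le_mul_of_nonneg_left (by linarith [(hs 0 le_rfl).2]) (by linarith)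
    have h5 := hclose t 0 (by rw [zero_sub, abs_neg, abs_of_nonneg ht]; linarith)
    linarith [dist_triangle_right (q t) (g 0) (q 0)]
  · set U := K * t + C + 2 * R with hU
    have hU0 : 0 ≤ U := by positivity
    have hsU : t ≤ s U := by
      have h2 := hq.upper (mem_univ 0) (mem_univ (s U))
      rw [zero_sub, abs_neg, abs_of_nonneg (hs U hU0).1] at h2
      have h3 := dist_triangle4 (g 0) (q 0) (q (s U)) (g U)
      rw [hg.dist_real, zero_sub, abs_neg, abs_of_nonneg hU0, dist_comm _ (g U)] at h3
      have h4 : K * t ≤ K * s U := by linarith [(hs U hU0).2]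
      exact le_of_mul_le_mul_left h4 (by linarith)
    obtain ⟨w, hw, hsw⟩ := coarse_intermediate_value (s := s) (c := t) (J := J) hU0 (by
      intro v hv w hw hvw hwv
      refine hq.abs_sub_le_of_near ?_ (hs v hv.1).2 (hs w hw.1).2
      rw [hg.dist_real, abs_sub_comm, abs_of_nonneg (by linarith)]
      linarith) h1.le hsU
    refine ⟨w, hw.1, ?_⟩
    linarith [dist_triangle_right (q t) (g w) (q (s w)), hclose t (s w) hsw, (hs w hw.1).2]

/-- A bi-infinite quasi-geodesic with Morse image is uniformly near a geodesic line. -/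
theorem exists_line_near [ProperSpace X] (hX : IsGeodesicSpace X) (K C : ℝ) (N : MorseGauge) :
    ∃ R : ℝ, 0 ≤ R ∧ ∀ q : ℝ → X, IsQuasiGeodesicOn K C q univ → IsMorse N (range q) →
      ∃ g : ℝ → X, Isometry g ∧ dist (g 0) (q 0) ≤ R ∧ RaysNear R g q ∧
        RaysNear R (fun t => g (-t)) (fun t => q (-t)) := by
  by_cases hKC : 1 ≤ K ∧ 0 ≤ C
  swap
  · exact ⟨0, le_rfl, fun q hq => absurd ⟨hq.1, hq.2.1⟩ hKC⟩
  obtain ⟨hK, hC⟩ := hKC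
  obtain ⟨R, hR, hgeo⟩ := exists_long_geodesic_near hX K C N
  have hRle : R + 1 ≤ K * (K * (2 * (R + 1) + 1 + C)) + C + (R + 1) := by
    have : 0 ≤ K * (K * (2 * (R + 1) + 1 + C)) := by positivity
    linarith
  refine ⟨K * (K * (2 * (R + 1) + 1 + C)) + C + (R + 1), by linarith, fun q hq hN => ?_⟩
  -- The closed condition at time `u` records which half of `q` is nearby, so the limit line
  -- inherits it.
  obtain ⟨g, hg, hg0, hgP⟩ := exists_line_of_long_geodesics (q 0) R
    (fun u => {x | (0 ≤ u → x ∈ cthickening R (q '' Ici 0)) ∧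
      (u ≤ 0 → x ∈ cthickening R (q '' Iic 0))})
    (fun u => by
      simp only [ofPred_and]
      refine IsClosed.inter ?_ ?_
      · by_cases hu : 0 ≤ u
        · simp only [hu, true_imp_iff]
          exact isClosed_cthickening
        · simp only [hu, false_imp_iff]
          exact isClosed_univ
      · by_cases hu : u ≤ 0
        · simp only [hu, true_imp_iff]
          exact isClosed_cthickening
        · simp only [hu, false_imp_iff]
          exact isClosed_univ)
    (fun n => by
      obtain ⟨γ, h1, h2, h3, h4⟩ := hgeo q hq hN n
      refine ⟨γ, h1, h2, fun u hu => ⟨fun hu0 => ?_, fun hu0 => ?_⟩⟩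
      · obtain ⟨t, ht, hd⟩ := h3 u ⟨hu0, hu.2⟩
        exact mem_cthickening_of_dist_le _ (q t) _ _ (mem_image_of_mem q ht) hd
      · obtain ⟨t, ht, hd⟩ := h4 u ⟨hu.1, hu0⟩
        exact mem_cthickening_of_dist_le _ (q t) _ _ (mem_image_of_mem q ht) hd)
  have hq' := hq.comp_neg
  rw [neg_univ] at hq'
  have hg0' : dist (g 0) (q 0) ≤ R + 1 := by linarith
  refine ⟨g, hg, hg0'.trans hRle, raysNear_of_quasiGeodesic hg hq hg0' fun u hu => ?_,
    raysNear_of_quasiGeodesic hg.comp_neg_real hq' (by simpa using hg0') fun u hu => ?_⟩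
  · obtain ⟨_, ⟨t, ht, rfl⟩, hd⟩ := exists_dist_le_of_mem_cthickening hR ((hgP u).1 hu)
    exact ⟨t, ht, hd⟩
  · obtain ⟨_, ⟨t, ht, rfl⟩, hd⟩ := exists_dist_le_of_mem_cthickening hR
      ((hgP (-u)).2 (by linarith))
    exact ⟨-t, by simpa using ht, by simpa using hd⟩

theorem RaysNear.exists_near_range {α β : ℝ → X} {H : ℝ} (hpos : RaysNear H α β)
    (hneg : RaysNear H (fun t => α (-t)) (fun t => β (-t))) :
    ∀ x ∈ range α, ∃ y ∈ range β, dist x y ≤ H := by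
  rintro _ ⟨t, rfl⟩
  rcases le_total 0 t with ht | ht
  · obtain ⟨s, -, hd⟩ := hpos.1 t ht
    exact ⟨_, mem_range_self s, hd⟩
  · obtain ⟨s, -, hd⟩ := hneg.1 (-t) (by linarith)
    exact ⟨_, mem_range_self (-s), by simpa using hd⟩

/-- The line obtained from `exists_line_near` is itself uniformly Morse. -/
theorem exists_morse_line_near [ProperSpace X] (hX : IsGeodesicSpace X) (K C : ℝ)
    (N : MorseGauge) :
    ∃ (R : ℝ) (N' : MorseGauge), 0 ≤ R ∧ ∀ q : ℝ → X, IsQuasiGeodesicOn K C q univ →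
      IsMorse N (range q) →
      ∃ g : ℝ → X, Isometry g ∧ IsMorse N' (range g) ∧ dist (g 0) (q 0) ≤ R ∧ RaysNear R g q ∧
        RaysNear R (fun t => g (-t)) (fun t => q (-t)) := by
  obtain ⟨R, hR, h⟩ := exists_line_near hX K C N
  obtain ⟨N', hN'⟩ := exists_gauge_of_near X N hR
  refine ⟨R, N', hR, fun q hq hN => ?_⟩
  obtain ⟨g, hg, h0, hpos, hneg⟩ := h q hq hN
  exact ⟨g, hg, hN' _ _ hN (hpos.symm.exists_near_range hneg.symm)
    (hpos.exists_near_range hneg), h0, hpos, hneg⟩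

end Lines

/-! ### Ends of lines and ideal triangles -/

section Boundary

variable {X : Type*} [MetricSpace X]

theorem asymptotic_iff {α β : ℝ → X} :
    Asymptotic (fun t : ℝ≥0 => α t) (fun t : ℝ≥0 => β t) ↔ ∃ H, RaysNear H α β := by
  constructor
  · intro h
    have h' : ∃ r : ℝ, hausdorffEDist (range fun t : ℝ≥0 => α t) (range fun t : ℝ≥0 => β t)
        < ENNReal.ofReal r := by
      refine ⟨(hausdorffEDist (range fun t : ℝ≥0 => α t) (range fun t : ℝ≥0 => β t)).toReal + 1,
        ?_⟩
      rw [ENNReal.lt_ofReal_iff_toReal_lt h]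
      linarith
    obtain ⟨r, hr⟩ := h'
    have key : ∀ a b : ℝ → X, hausdorffEDist (range fun t : ℝ≥0 => a t)
        (range fun t : ℝ≥0 => b t) < ENNReal.ofReal r → ∀ u ≥ 0, ∃ s ≥ 0, dist (a u) (b s) ≤ r := by
      intro a b hab u hu
      obtain ⟨_, ⟨s, rfl⟩, hs⟩ := exists_edist_lt_of_hausdorffEDist_lt
        (mem_range_self (f := fun t : ℝ≥0 => a t) ⟨u, hu⟩) hab
      refine ⟨s, s.2, ?_⟩
      rw [edist_dist] at hs
      exact (ENNReal.ofReal_lt_ofReal_iff_of_nonneg dist_nonneg).1 hs |>.le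
    exact ⟨r, key α β hr, key β α (by rwa [hausdorffEDist_comm])⟩
  · rintro ⟨H, hH⟩
    refine ne_top_of_le_ne_top (ENNReal.ofReal_ne_top (r := H)) (hausdorffEDist_le_of_mem_edist
      ?_ ?_)
    · rintro _ ⟨t, rfl⟩
      obtain ⟨s, hs, hd⟩ := hH.1 t t.2
      exact ⟨_, mem_range_self ⟨s, hs⟩, by rw [edist_dist]; exact ENNReal.ofReal_le_ofReal hd⟩
    · rintro _ ⟨t, rfl⟩
      obtain ⟨s, hs, hd⟩ := hH.2 t t.2
      exact ⟨_, mem_range_self ⟨s, hs⟩, by rw [edist_dist]; exact ENNReal.ofReal_le_ofReal hd⟩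

theorem Asymptotic.trans {σ τ ρ : ℝ≥0 → X} (h₁ : Asymptotic σ τ) (h₂ : Asymptotic τ ρ) :
    Asymptotic σ ρ :=
  ne_top_of_le_ne_top (ENNReal.add_ne_top.2 ⟨h₁, h₂⟩) hausdorffEDist_triangle

theorem Asymptotic.symm {σ τ : ℝ≥0 → X} (h : Asymptotic σ τ) : Asymptotic τ σ := by
  unfold Asymptotic at *
  rwa [hausdorffEDist_comm]

theorem RaysNear.convergesTo {α β : ℝ → X} {H : ℝ} {p : MorseBoundary X} (h : RaysNear H α β)
    (hβ : ConvergesTo (fun t : ℝ≥0 => β t) p) : ConvergesTo (fun t : ℝ≥0 => α t) p := by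
  obtain ⟨τ, hτ, hβτ⟩ := hβ
  exact ⟨τ, hτ, (asymptotic_iff.2 ⟨H, h⟩).trans hβτ⟩

theorem ConvergesTo.exists_raysNear {α β : ℝ → X} {p : MorseBoundary X}
    (hα : ConvergesTo (fun t : ℝ≥0 => α t) p) (hβ : ConvergesTo (fun t : ℝ≥0 => β t) p) :
    ∃ H, RaysNear H α β := by
  obtain ⟨σ, hσ, hασ⟩ := hα
  obtain ⟨τ, hτ, hβτ⟩ := hβ
  have hστ : Asymptotic σ.1 τ.1 := Quotient.exact (hσ.trans hτ.symm)
  exact asymptotic_iff.1 ((hασ.trans hστ).trans hβτ.symm)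

theorem exists_convergesTo {α : ℝ → X} (hα : Isometry α) {N : MorseGauge}
    (hN : IsMorse N (α '' Ici 0)) : ∃ p, ConvergesTo (fun t : ℝ≥0 => α t) p := by
  have hr : range (fun t : ℝ≥0 => α t) = α '' Ici 0 := by
    ext x
    constructor
    · rintro ⟨t, rfl⟩
      exact mem_image_of_mem α t.2
    · rintro ⟨t, ht, rfl⟩
      exact ⟨⟨t, ht⟩, rfl⟩
  refine ⟨Quotient.mk (MorseRay.setoid X) ⟨fun t : ℝ≥0 => α t, hα.comp isometry_subtype_coe, N, ?_⟩,
    _, rfl, ?_⟩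
  · rwa [hr]
  · exact asymptotic_iff.2 ⟨0, RaysNear.of_dist_le fun u _ => (dist_self _).le⟩

theorem exists_isLineFromTo {α : ℝ → X} (hα : Isometry α) {N : MorseGauge}
    (hN : IsMorse N (range α)) : ∃ p q, IsLineFromTo α p q := by
  obtain ⟨N', h⟩ := exists_gauge_halves X N
  obtain ⟨hpos, hneg, -⟩ := h α hα hN
  obtain ⟨p, hp⟩ := exists_convergesTo hα.comp_neg_real hneg
  obtain ⟨q, hq⟩ := exists_convergesTo hα hpos
  exact ⟨p, q, hα, hp, hq⟩

namespace IsLineFromTo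

variable {α β : ℝ → X} {p q : MorseBoundary X}

theorem reverse (h : IsLineFromTo α p q) : IsLineFromTo (fun t => α (-t)) q p :=
  ⟨h.1.comp_neg_real, by simpa only [neg_neg] using h.2.2, h.2.1⟩

theorem translate (h : IsLineFromTo α p q) (c : ℝ) : IsLineFromTo (fun t => α (t + c)) p q := by
  refine ⟨h.1.comp (IsometryEquiv.addRight c).isometry, ?_, ?_⟩
  · refine RaysNear.convergesTo (α := fun t => α (-t + c)) (β := fun t => α (-t)) (H := |c|)
      (RaysNear.of_dist_le fun u _ => ?_) h.2.1
    rw [h.1.dist_real, add_sub_cancel_left]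
  · refine RaysNear.convergesTo (α := fun t => α (t + c)) (H := |c|)
      (RaysNear.of_dist_le fun u _ => ?_) h.2.2
    rw [h.1.dist_real, add_sub_cancel_left]

theorem ne (h : IsLineFromTo α p q) : p ≠ q := by
  rintro rfl
  obtain ⟨H, hH⟩ := ConvergesTo.exists_raysNear (α := fun t => α (-t)) h.2.1 h.2.2
  have hH0 : 0 ≤ H := by
    obtain ⟨s, -, hd⟩ := hH.1 0 le_rfl
    exact dist_nonneg.trans hd
  obtain ⟨s, hs, hd⟩ := hH.1 (H + 1) (by linarith)
  rw [h.1.dist_real, abs_sub_comm, sub_neg_eq_add, abs_of_nonneg (by linarith)] at hd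
  linarith

end IsLineFromTo

/-- Projections of `β` to `α` run from one end to the other in bounded jumps, so every point of `α`
is approached. The non-uniform `H` only decides how far out to start, and is absent from the bound.
-/
theorem exists_dist_le_of_raysNear {α β : ℝ → X} (hα : Isometry α) (hβ : Isometry β) {H R : ℝ}
    (hpos : RaysNear H β α) (hneg : RaysNear H (fun t => β (-t)) (fun t => α (-t)))
    (hR : ∀ t, ∃ s, dist (β t) (α s) ≤ R) (c : ℝ) : ∃ t, dist (α c) (β t) ≤ 3 * R + 1 := by
  have hR0 : 0 ≤ R := by
    obtain ⟨s, hs⟩ := hR 0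
    exact dist_nonneg.trans hs
  choose s hs using hR
  have hH0 : 0 ≤ H := by
    obtain ⟨s, -, hd⟩ := hpos.1 0 le_rfl
    exact dist_nonneg.trans hd
  set d := dist (α 0) (β 0) with hd
  have hd0 : 0 ≤ d := dist_nonneg
  set M := |c| + 2 * H + R + d with hM
  have hM0 : 0 ≤ M := by positivity
  have hc := abs_le.1 (le_refl |c|)
  have hright : c ≤ s M := by
    obtain ⟨u, hu, hud⟩ := hpos.1 M hM0
    have h1 := dist_triangle4 (β 0) (α 0) (α u) (β M)
    rw [hβ.dist_real, hα.dist_real, zero_sub, zero_sub, abs_neg, abs_neg, abs_of_nonneg hu,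
      abs_of_nonneg hM0, dist_comm (β 0), dist_comm (α u)] at h1
    have h2 := dist_triangle_left (α u) (α (s M)) (β M)
    rw [hα.dist_real] at h2
    have h3 := (abs_le.1 (h2.trans (add_le_add hud (hs M)))).2
    linarith
  have hleft : s (-M) ≤ c := by
    obtain ⟨u, hu, hud⟩ := hneg.1 M hM0
    have h1 := dist_triangle4 (β 0) (α 0) (α (-u)) (β (-M))
    rw [hβ.dist_real, hα.dist_real, zero_sub, zero_sub, neg_neg, neg_neg, abs_of_nonneg hu,
      abs_of_nonneg hM0, dist_comm (β 0), dist_comm (α (-u))] at h1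
    have h2 := dist_triangle_left (α (-u)) (α (s (-M))) (β (-M))
    rw [hα.dist_real] at h2
    have h3 := (abs_le.1 (h2.trans (add_le_add hud (hs (-M))))).1
    linarith
  obtain ⟨t, -, ht⟩ := coarse_intermediate_value (s := s) (c := c) (J := 2 * R + 1)
    (show -M ≤ M by linarith) (by
      intro v _ w _ hvw hwv
      have h1 := dist_triangle4 (α (s v)) (β v) (β w) (α (s w))
      rw [hα.dist_real, hβ.dist_real, abs_sub_comm v w, abs_of_nonneg (show 0 ≤ w - v by linarith),
        dist_comm (α (s v))] at h1
      linarith [hs v, hs w]) hleft hright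
  refine ⟨t, ?_⟩
  have h1 := dist_triangle_right (α c) (β t) (α (s t))
  rw [hα.dist_real, abs_sub_comm] at h1
  linarith [hs t]

/-- All lines with the same endpoints as a Morse line are uniformly Morse. -/
theorem exists_gauge_same_ends (hX : IsGeodesicSpace X) (N : MorseGauge) :
    ∃ N' : MorseGauge, ∀ (α β : ℝ → X) (p q : MorseBoundary X), IsLineFromTo α p q →
      IsLineFromTo β p q → IsMorse N (range α) → IsMorse N' (range β) := by
  have hD : (0 : ℝ) ≤ 3 * (N 9 4 + 1) + 1 := by positivity
  obtain ⟨N', hN'⟩ := exists_gauge_of_near X N hD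
  refine ⟨N', fun α β p q hα hβ hN => ?_⟩
  obtain ⟨H, hH⟩ := hβ.2.2.exists_raysNear hα.2.2
  obtain ⟨H', hH'⟩ := ConvergesTo.exists_raysNear (α := fun t => β (-t)) (β := fun t => α (-t))
    hβ.2.1 hα.2.1
  have hpos : RaysNear (max H H') β α :=
    ⟨fun u hu => (hH.1 u hu).imp fun s hs => ⟨hs.1, hs.2.trans (le_max_left _ _)⟩,
      fun u hu => (hH.2 u hu).imp fun s hs => ⟨hs.1, hs.2.trans (le_max_left _ _)⟩⟩
  have hneg : RaysNear (max H H') (fun t => β (-t)) (fun t => α (-t)) :=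
    ⟨fun u hu => (hH'.1 u hu).imp fun s hs => ⟨hs.1, hs.2.trans (le_max_right _ _)⟩,
      fun u hu => (hH'.2 u hu).imp fun s hs => ⟨hs.1, hs.2.trans (le_max_right _ _)⟩⟩
  have hnear : ∀ t, ∃ s, dist (β t) (α s) ≤ N 9 4 + 1 := by
    intro t
    obtain ⟨_, ⟨s, rfl⟩, hs⟩ := hN.line_near hX hβ.1 (H := max H H')
      (fun u hu => by
        obtain ⟨s, -, hs⟩ := hpos.1 u hu
        exact ⟨_, mem_range_self s, hs⟩)
      (fun u hu => by
        obtain ⟨s, -, hs⟩ := hneg.1 (-u) (by linarith)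
        exact ⟨_, mem_range_self (-s), by simpa using hs⟩) t
    exact ⟨s, hs⟩
  refine hN' _ _ hN ?_ ?_
  · rintro _ ⟨c, rfl⟩
    obtain ⟨t, ht⟩ := exists_dist_le_of_raysNear hα.1 hβ.1 hpos hneg hnear c
    exact ⟨_, mem_range_self t, ht⟩
  · rintro _ ⟨t, rfl⟩
    obtain ⟨s, hs⟩ := hnear t
    exact ⟨_, mem_range_self s, by linarith [(N 9 4).coe_nonneg]⟩

/-- The vertices of an ideal triangle with Morse sides. -/
theorem exists_gauge_morseTuples (hX : IsGeodesicSpace X) (N : MorseGauge) :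
    ∃ N' : MorseGauge, ∀ (α β γ : ℝ → X) (p q r : MorseBoundary X), IsLineFromTo α p q →
      IsLineFromTo β q r → IsLineFromTo γ r p → IsMorse N (range α) → IsMorse N (range β) →
      IsMorse N (range γ) → ![p, q, r] ∈ morseTuples X 3 N' := by
  obtain ⟨N', hN'⟩ := exists_gauge_same_ends hX N
  refine ⟨N', fun α β γ p q r hα hβ hγ hNα hNβ hNγ => ⟨?_, ?_⟩⟩
  · have h1 := hα.ne
    have h2 := hβ.ne
    have h3 := hγ.ne
    intro i j hij
    fin_cases i <;> fin_cases j <;> simp_all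
  · have key : ∀ (a b : ℝ → X) (x y : MorseBoundary X), IsLineFromTo a x y → IsLineFromTo b y x →
        IsMorse N (range a) → IsMorse N' (range b) := by
      intro a b x y ha hb hNa
      have := hN' _ _ _ _ ha hb.reverse hNa
      rwa [← (neg_surjective (G := ℝ)).range_comp b]
    intro i j hij δ hδ
    fin_cases i <;> fin_cases j
    · exact absurd rfl hij
    · exact hN' _ _ _ _ hα hδ hNα
    · exact key _ _ _ _ hγ hδ hNγ
    · exact key _ _ _ _ hα hδ hNα
    · exact absurd rfl hij
    · exact hN' _ _ _ _ hβ hδ hNβ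
    · exact hN' _ _ _ _ hγ hδ hNγ
    · exact key _ _ _ _ hβ hδ hNβ
    · exact absurd rfl hij

end Boundary

/-! ### Invariance of center-exhaustiveness, and equivalence with richness -/

section CenterExhaustive

theorem range_comp_neg_real {X : Type*} (α : ℝ → X) : range (fun t => α (-t)) = range α :=
  (neg_surjective (G := ℝ)).range_comp α

theorem RaysNear.map {X Y : Type*} [MetricSpace X] [MetricSpace Y] {K C H : ℝ} {f : X → Y}
    (hf : IsQIEmbedding K C f) {α β : ℝ → X} (h : RaysNear H α β) :
    RaysNear (K * H + C) (fun t => f (α t)) (fun t => f (β t)) := by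
  have hK : 0 ≤ K := by linarith [hf.1]
  have key : ∀ x y : X, dist x y ≤ H → dist (f x) (f y) ≤ K * H + C := fun x y hxy =>
    (hf.2.2 x y).2.trans (by gcongr)
  exact ⟨fun u hu => (h.1 u hu).imp fun s hs => ⟨hs.1, key _ _ hs.2⟩,
    fun u hu => (h.2 u hu).imp fun s hs => ⟨hs.1, key _ _ hs.2⟩⟩

theorem IsQIEmbedding.comp_isometry {X Y : Type*} [MetricSpace X] [MetricSpace Y] {K C : ℝ}
    {f : X → Y} (hf : IsQIEmbedding K C f) {α : ℝ → X} (hα : Isometry α) :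
    IsQuasiGeodesicOn K C (fun t => f (α t)) univ := by
  refine ⟨hf.1, hf.2.1, fun v _ w _ hvw => ?_⟩
  have := hf.2.2 (α v) (α w)
  rwa [hα.dist_real, abs_sub_comm, abs_of_nonneg (by linarith), one_div, ← div_eq_inv_mul] at this

theorem CenterExhaustive.of_isQuasiIsometry {X Y : Type*} [MetricSpace X] [MetricSpace Y]
    [ProperSpace Y] (hY : IsGeodesicSpace Y) {f : X → Y} (hf : IsQuasiIsometry f)
    (h : CenterExhaustive X) : CenterExhaustive Y := by
  obtain ⟨N, K, hK, hcenter⟩ := h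
  obtain ⟨N₁, hN₁⟩ := exists_gauge_image hf N
  obtain ⟨K₀, C₀, hqi, hdense⟩ := hf
  have hK₀ : 0 ≤ K₀ := by linarith [hqi.1]
  have hC₀ := hqi.2.1
  obtain ⟨R, N₂, hR, hline⟩ := exists_morse_line_near hY K₀ C₀ N₁
  obtain ⟨N₃, hN₃⟩ := exists_gauge_morseTuples hY N₂
  refine ⟨N₃, (C₀ + 1) + (K₀ * (K + 1) + C₀) + R, by positivity, fun y => ?_⟩
  obtain ⟨_, ⟨x, rfl⟩, hx⟩ := exists_dist_le_of_mem_cthickening (A := range f) (x := y) hC₀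
    (by rw [hdense]; trivial)
  obtain ⟨p, q, r, ⟨-, hM⟩, α, β, γ, hα, hβ, hγ, hxα, hxβ, hxγ⟩ := hcenter x
  have push : ∀ (δ : ℝ → X) (a b : MorseBoundary X), IsLineFromTo δ a b → IsMorse N (range δ) →
      x ∈ cthickening K (range δ) → ∃ (δ' : ℝ → X) (g : ℝ → Y), IsLineFromTo δ' a b ∧ Isometry g ∧
        IsMorse N₂ (range g) ∧ RaysNear R g (fun t => f (δ' t)) ∧
        RaysNear R (fun t => g (-t)) (fun t => f (δ' (-t))) ∧
        y ∈ cthickening ((C₀ + 1) + (K₀ * (K + 1) + C₀) + R) (range g) := by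
    intro δ a b hδ hNδ hxδ
    obtain ⟨_, ⟨s, rfl⟩, hs⟩ := exists_dist_le_of_mem_cthickening hK hxδ
    -- Translating puts the point near `x` at time `0`, where the straightened line is known to be
    -- close to its quasi-geodesic.
    have hδ' := hδ.translate s
    have hrange : range (fun t => δ (t + s)) = range δ :=
      (IsometryEquiv.addRight s).surjective.range_comp δ
    obtain ⟨g, hg, hNg, hg0, hpos, hneg⟩ := hline _ (hqi.comp_isometry hδ'.1) (by
      have := hN₁ _ hNδ
      rwa [← hrange, ← range_comp] at this)
    refine ⟨_, g, hδ', hg, hNg, hpos, hneg,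
      mem_cthickening_of_dist_le _ _ _ _ (mem_range_self 0) ?_⟩
    have h1 : dist (f x) (f (δ (0 + s))) ≤ K₀ * (K + 1) + C₀ := by
      rw [zero_add]
      refine (hqi.2.2 _ _).2.trans ?_
      gcongr
    rw [dist_comm] at hg0
    linarith [dist_triangle4 y (f x) (f (δ (0 + s))) (g 0)]
  obtain ⟨α', a, hα', ha, hNa, ha1, ha2, hya⟩ := push α p q hα (hM 0 1 (by decide) α hα) hxα
  obtain ⟨β', b, hβ', hb, hNb, hb1, hb2, hyb⟩ := push β q r hβ (hM 1 2 (by decide) β hβ) hxβ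
  obtain ⟨γ', c, hγ', hc, hNc, hc1, hc2, hyc⟩ := push γ r p hγ (hM 2 0 (by decide) γ hγ) hxγ
  obtain ⟨p', q', haL⟩ := exists_isLineFromTo ha hNa
  obtain ⟨-, r', -, -, hbr⟩ := exists_isLineFromTo hb hNb
  -- Sides meeting at a vertex are asymptotic in the source; `f` preserves this, so the straightened
  -- lines share ends.
  obtain ⟨H₁, hH₁⟩ := ConvergesTo.exists_raysNear (α := fun t => β' (-t)) hβ'.2.1 hα'.2.2
  obtain ⟨H₂, hH₂⟩ := ConvergesTo.exists_raysNear (α := fun t => γ' (-t)) hγ'.2.1 hβ'.2.2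
  obtain ⟨H₃, hH₃⟩ := ConvergesTo.exists_raysNear (β := fun t => α' (-t)) hγ'.2.2 hα'.2.1
  have hbL : IsLineFromTo b q' r' :=
    ⟨hb, ((hb2.trans (hH₁.map hqi)).trans ha1.symm).convergesTo haL.2.2, hbr⟩
  have hcL : IsLineFromTo c r' p' :=
    ⟨hc, ((hc2.trans (hH₂.map hqi)).trans hb1.symm).convergesTo hbr,
      ((hc1.trans (hH₃.map hqi)).trans ha2.symm).convergesTo haL.2.1⟩
  exact ⟨p', q', r', hN₃ a b c p' q' r' haL hbL hcL hNa hNb hNc, a, b, c, haL, hbL, hcL,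
    hya, hyb, hyc⟩

variable {X : Type*} [MetricSpace X]

/-- If `x₂` is much closer to the line `α` than `x₁` is to `x₂`, then any Morse set containing
`x₁` and `x₂` passes near a point of `α` at distance `t` from the base point. -/
theorem IsMorse.near_of_infDist_le (hX : IsGeodesicSpace X) {N : MorseGauge} {S : Set X}
    (hN : IsMorse N S) {x₁ x₂ : X} (h₁ : x₁ ∈ S) (h₂ : x₂ ∈ S) {α : ℝ → X} (hα : Isometry α)
    {D t : ℝ} (ht : 0 ≤ t) (hD : dist x₁ (α 0) ≤ D)
    (hinf : infDist x₂ (range α) ≤ dist x₁ x₂ - (t + D + 2)) :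
    (∃ z ∈ S, dist (α t) z ≤ N 3 (2 + 2 * D) + 1 + D) ∨
      ∃ z ∈ S, dist (α (-t)) z ≤ N 3 (2 + 2 * D) + 1 + D := by
  have hD0 : 0 ≤ D := dist_nonneg.trans hD
  obtain ⟨v, -, hnear⟩ := exists_almost_nearest α (s := univ) ⟨0, trivial⟩ x₂
  have key : ∀ (β : ℝ → X) (w : ℝ), Isometry β → dist x₁ (β 0) ≤ D → t ≤ w →
      (∀ u, dist x₂ (β w) ≤ dist x₂ (β u) + 1) →
      ∃ z ∈ S, dist (β t) z ≤ N 3 (2 + 2 * D) + 1 + D := by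
    intro β w hβ hβD htw hw
    -- The path along `β` to `β w` and then to `x₂` has its ends near `S` and passes through `β t`.
    obtain ⟨q, hq, heq, hend⟩ := (hβ.isQuasiGeodesicOn (Icc 0 w)).exists_concat hX
      (v := w) ⟨ht.trans htw, le_rfl⟩ x₂ (fun u _ => hw u)
    obtain ⟨z, hz, hd⟩ := hN.exists_dist_le_of_near hD0 (t := t) hq h₁ h₂
      (by rwa [heq 0 (ht.trans htw), dist_comm]) (by rwa [hend, dist_self])
      ⟨ht, by linarith [dist_nonneg (x := x₂) (y := β w)]⟩
    rw [heq t htw] at hd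
    norm_num at hd
    exact ⟨z, hz, hd⟩
  have hv : t ≤ |v| := by
    have h3 : dist x₂ (α v) - 1 ≤ infDist x₂ (range α) := by
      refine (le_infDist (range_nonempty α)).2 ?_
      rintro _ ⟨w, rfl⟩
      linarith [hnear w trivial]
    have h4 := dist_triangle4 x₁ (α 0) (α v) x₂
    rw [hα.dist_real, zero_sub, abs_neg, dist_comm (α v)] at h4
    linarith
  rcases le_abs.1 hv with h | h
  · exact Or.inl (key α v hα hD h fun u => hnear u trivial)
  · refine Or.inr (key (fun s => α (-s)) (-v) hα.comp_neg_real (by simpa using hD) h fun u => ?_)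
    rw [neg_neg]
    exact hnear (-u) trivial

/-- The Hausdorff distance of asymptotic rays is finite but not uniform; the Morse property replaces
it by a bound depending only on `N` and `D`. -/
theorem exists_asymptotic_rays_bound (hX : IsGeodesicSpace X) (N : MorseGauge) (D : ℝ) :
    ∃ R : ℝ, 0 ≤ R ∧ ∀ (α β : ℝ → X) (p : MorseBoundary X), Isometry α → Isometry β →
      IsMorse N (range α) → ConvergesTo (fun t : ℝ≥0 => α t) p →
      ConvergesTo (fun t : ℝ≥0 => β t) p → dist (α 0) (β 0) ≤ D →
      ∀ t ≥ 0, dist (α t) (β t) ≤ R := by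
  by_cases hD : 0 ≤ D
  swap
  · exact ⟨0, le_rfl, fun α β p _ _ _ _ _ h => absurd (dist_nonneg.trans h) hD⟩
  obtain ⟨N', hN'⟩ := exists_gauge_halves X N
  refine ⟨2 * (N' 3 (2 + 2 * D) + 1 + D) + D, by positivity,
    fun α β p hα hβ hN hαp hβp h t ht => ?_⟩
  obtain ⟨H, hH⟩ := hβp.exists_raysNear hαp
  obtain ⟨_, ⟨s, hs, rfl⟩, hd⟩ := (hN' α hα hN).1.ray_near hX hβ (H := H) (D := D)
    (mem_image_of_mem α (show (0 : ℝ) ∈ Ici 0 from le_refl (0 : ℝ))) (by rwa [dist_comm])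
    (fun u hu => by
      obtain ⟨s, hs, hd⟩ := hH.1 u hu
      exact ⟨α s, mem_image_of_mem α hs, hd⟩) ht
  exact dist_le_of_rays_near hα hβ h hs ht hd

theorem CenterExhaustive.morseGeodesicallyRich (hX : IsGeodesicSpace X) (h : CenterExhaustive X) :
    MorseGeodesicallyRich X := by
  obtain ⟨N, K, hK, hcenter⟩ := h
  obtain ⟨Q, hQ, hrays⟩ := exists_asymptotic_rays_bound hX N ((K + 1) + (K + 1))
  refine ⟨N, K + 2, by linarith, fun N' => ?_⟩
  set D := K + 1 with hD
  set R : ℝ := N' 3 (2 + 2 * D) + 1 + D with hR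
  have hR0 : 0 ≤ R := by positivity
  -- Chosen so that `2 * t` exceeds `4 * (R + Q) + 2 * D`, which makes `not_both` a contradiction.
  set t := 2 * (R + Q) + D + 1 with ht
  have ht0 : 0 ≤ t := by positivity
  refine ⟨t + D + 2, fun x₁ x₂ hjoin => ?_⟩
  obtain ⟨L, η, hη, hη0, hηL, hN'⟩ := hjoin
  have h₁ : x₁ ∈ range η := ⟨_, hη0⟩
  have h₂ : x₂ ∈ range η := ⟨_, hηL⟩
  have hS : ∀ z ∈ range η, ∀ w ∈ range η, dist z w = |dist x₁ z - dist x₁ w| := by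
    rintro _ ⟨u, rfl⟩ _ ⟨v, rfl⟩
    rw [← hη0, hη.dist_eq, hη.dist_eq, hη.dist_eq, Subtype.dist_eq, Subtype.dist_eq,
      Subtype.dist_eq, Real.dist_eq, Real.dist_eq, Real.dist_eq]
    dsimp only
    rw [zero_sub, zero_sub, abs_neg, abs_neg, abs_of_nonneg u.2.1, abs_of_nonneg v.2.1]
  obtain ⟨p, q, r, ⟨-, hM⟩, α, β, γ, hα, hβ, hγ, hxα, hxβ, hxγ⟩ := hcenter x₁
  have base : ∀ (δ : ℝ → X) (a b : MorseBoundary X), IsLineFromTo δ a b → IsMorse N (range δ) →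
      x₁ ∈ cthickening K (range δ) → ∃ δ' : ℝ → X, IsLineFromTo δ' a b ∧ IsMorse N (range δ') ∧
        dist x₁ (δ' 0) ≤ D := by
    intro δ a b hδ hNδ hxδ
    obtain ⟨_, ⟨s, rfl⟩, hs⟩ := exists_dist_le_of_mem_cthickening hK hxδ
    refine ⟨_, hδ.translate s, ?_, by rwa [zero_add]⟩
    rwa [show range (fun t => δ (t + s)) = range δ from
      (IsometryEquiv.addRight s).surjective.range_comp δ]
  obtain ⟨a, ha, hNa, hxa⟩ := base α p q hα (hM 0 1 (by decide) α hα) hxα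
  obtain ⟨b, hb, hNb, hxb⟩ := base β q r hβ (hM 1 2 (by decide) β hβ) hxβ
  obtain ⟨c, hc, hNc, hxc⟩ := base γ r p hγ (hM 2 0 (by decide) γ hγ) hxγ
  have hend : ∀ (δ ε : ℝ → X) (o : MorseBoundary X), Isometry δ → Isometry ε →
      IsMorse N (range δ) → ConvergesTo (fun t : ℝ≥0 => δ t) o →
      ConvergesTo (fun t : ℝ≥0 => ε (-t)) o → dist x₁ (δ 0) ≤ D → dist x₁ (ε 0) ≤ D →
      dist (δ t) (ε (-t)) ≤ Q := by
    intro δ ε o hδ hε hNδ hδo hεo h3 h4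
    exact hrays δ (fun t => ε (-t)) o hδ hε.comp_neg_real hNδ hδo hεo
      (by rw [neg_zero]; linarith [dist_triangle_left (δ 0) (ε 0) x₁]) t ht0
  have hab := hend a b q ha.1 hb.1 hNa ha.2.2 hb.2.1 hxa hxb
  have hbc := hend b c r hb.1 hc.1 hNb hb.2.2 hc.2.1 hxb hxc
  have hca := hend c a p hc.1 ha.1 hNc hc.2.2 ha.2.1 hxc hxa
  -- Points of the segment near `δ t` and `δ (-t)` are both at distance about `t` from its initial
  -- point `x₁`, hence close together, whereas `δ t` and `δ (-t)` are `2 * t` apart.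
  have not_both : ∀ δ : ℝ → X, Isometry δ → dist x₁ (δ 0) ≤ D →
      (∃ z ∈ range η, dist (δ t) z ≤ R + Q) → ¬ ∃ z ∈ range η, dist (δ (-t)) z ≤ R + Q := by
    rintro δ hδ hxδ ⟨z, hz, hzd⟩ ⟨w, hw, hwd⟩
    have h3 : ∀ s, |s| = t → ∀ z, dist (δ s) z ≤ R + Q → |dist x₁ z - t| ≤ D + (R + Q) := by
      intro s hs z hz
      have h4 := hδ.dist_real 0 s
      rw [zero_sub, abs_neg, hs] at h4
      have h5 := dist_triangle4 x₁ (δ 0) (δ s) z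
      have h6 := dist_triangle4 (δ 0) x₁ z (δ s)
      rw [dist_comm (δ 0) x₁, dist_comm z] at h6
      exact abs_le.2 ⟨by linarith, by linarith⟩
    have h4 := abs_le.1 (h3 t (abs_of_nonneg ht0) z hzd)
    have h5 := abs_le.1 (h3 (-t) (by rw [abs_neg, abs_of_nonneg ht0]) w hwd)
    have h6 : dist z w ≤ 2 * (D + (R + Q)) := by
      rw [hS z hz w hw]
      exact abs_le.2 ⟨by linarith, by linarith⟩
    have h7 := dist_triangle4 (δ t) z w (δ (-t))
    rw [hδ.dist_real, sub_neg_eq_add, abs_of_nonneg (by linarith), dist_comm w] at h7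
    linarith
  have near_trans : ∀ x y : X, dist x y ≤ Q → (∃ z ∈ range η, dist x z ≤ R) →
      ∃ z ∈ range η, dist y z ≤ R + Q := by
    rintro x y hxy ⟨z, hz, hd⟩
    exact ⟨z, hz, by linarith [dist_triangle_left y z x]⟩
  have near_self : ∀ x : X, (∃ z ∈ range η, dist x z ≤ R) → ∃ z ∈ range η, dist x z ≤ R + Q :=
    fun x => near_trans x x (by rwa [dist_self])
  have upper : ∀ δ : ℝ → X, dist x₁ (δ 0) ≤ D → infDist x₁ (range δ) < K + 2 ∧
      infDist x₂ (range δ) - dist x₁ x₂ < t + D + 2 := by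
    intro δ hδ
    have h3 := infDist_le_dist_of_mem (x := x₁) (mem_range_self (f := δ) 0)
    have h4 := infDist_le_dist_of_mem (x := x₂) (mem_range_self (f := δ) 0)
    have h5 := dist_triangle_left x₂ (δ 0) x₁
    exact ⟨by linarith, by linarith⟩
  by_contra! hcon
  have far : ∀ δ : ℝ → X, Isometry δ → IsMorse N (range δ) → dist x₁ (δ 0) ≤ D →
      (∃ z ∈ range η, dist (δ t) z ≤ R) ∨ ∃ z ∈ range η, dist (δ (-t)) z ≤ R := by
    intro δ hδ hNδ hxδ
    obtain ⟨h3, h4⟩ := upper δ hxδ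
    refine hN'.near_of_infDist_le hX h₁ h₂ hδ ht0 hxδ ?_
    rcases le_abs.1 (hcon δ hδ hNδ h3) with h5 | h5 <;> linarith
  have na := not_both a ha.1 hxa
  have nb := not_both b hb.1 hxb
  have nc := not_both c hc.1 hxc
  -- Each side selects one of its two vertices. Three sides cannot all select the same vertex, and
  -- two selections at different vertices force, through a shared vertex, both ends of some side.
  rcases far a ha.1 hNa hxa with h3 | h3
  · rcases far b hb.1 hNb hxb with h4 | h4
    · exact nb (near_self _ h4) (near_trans _ _ hab h3)
    · rcases far c hc.1 hNc hxc with h5 | h5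
      · exact na (near_self _ h3) (near_trans _ _ hca h5)
      · exact nb (near_trans _ _ (by rwa [dist_comm]) h5) (near_self _ h4)
  · rcases far b hb.1 hNb hxb with h4 | h4
    · rcases far c hc.1 hNc hxc with h5 | h5
      · exact nc (near_self _ h5) (near_trans _ _ hbc h4)
      · exact nc (near_trans _ _ (by rwa [dist_comm]) h3) (near_self _ h5)
    · exact na (near_trans _ _ (by rwa [dist_comm]) h4) (near_self _ h3)

/-- Two diverging Morse rays are the two ends of a uniformly Morse line. -/
theorem exists_line_joining_rays [ProperSpace X] (hX : IsGeodesicSpace X) (N : MorseGauge)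
    {D c : ℝ} (hD : 0 ≤ D) (hDc : D ≤ c) :
    ∃ (R : ℝ) (N' : MorseGauge), 0 ≤ R ∧ ∀ σ τ : ℝ → X, Isometry σ → Isometry τ →
      IsMorse N (σ '' Ici 0) → IsMorse N (τ '' Ici 0) → dist (σ 0) (τ 0) ≤ D →
      (∀ s ≥ 0, ∀ t ≥ 0, s + t ≤ 3 * dist (σ s) (τ t) + c) →
      ∃ (g : ℝ → X) (H : ℝ), Isometry g ∧ IsMorse N' (range g) ∧ dist (g 0) (τ 0) ≤ R ∧
        RaysNear H g τ ∧ RaysNear H (fun t => g (-t)) σ := by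
  obtain ⟨N₁, hN₁⟩ := exists_gauge_union hX N D
  obtain ⟨N₂, hN₂⟩ := exists_gauge_of_near X N₁ hD
  obtain ⟨R, N₃, hR, hline⟩ := exists_morse_line_near hX 3 c N₂
  refine ⟨R, N₃, hR, fun σ τ hσ hτ hNσ hNτ h0 hdiv => ?_⟩
  have h0I : (0 : ℝ) ∈ Ici 0 := le_refl (0 : ℝ)
  have hj0 : joinRays σ τ 0 = τ 0 := joinRays_of_nonneg _ _ le_rfl
  have hMorse : IsMorse N₂ (range (joinRays σ τ)) := by
    refine hN₂ _ _ (hN₁ _ _ _ _ hNσ hNτ (mem_image_of_mem σ h0I) (mem_image_of_mem τ h0I) h0)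
      ?_ ?_
    · rintro _ (⟨s, hs, rfl⟩ | ⟨s, hs, rfl⟩)
      · rcases (show (0 : ℝ) ≤ s from hs).eq_or_lt with h | h
        · exact ⟨_, mem_range_self 0, by rwa [hj0, ← h]⟩
        · refine ⟨_, mem_range_self (-s), ?_⟩
          rwa [joinRays_of_neg _ _ (by linarith), neg_neg, dist_self]
      · exact ⟨_, mem_range_self s, by rwa [joinRays_of_nonneg _ _ hs, dist_self]⟩
    · rintro _ ⟨s, rfl⟩
      rcases le_or_gt 0 s with hs | hs
      · exact ⟨_, Or.inr (mem_image_of_mem τ hs), by rwa [joinRays_of_nonneg _ _ hs, dist_self]⟩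
      · refine ⟨_, Or.inl (mem_image_of_mem σ (show -s ∈ Ici 0 from ?_)), ?_⟩
        · exact neg_nonneg.2 hs.le
        · rwa [joinRays_of_neg _ _ hs, dist_self]
  obtain ⟨g, hg, hNg, hg0, hpos, hneg⟩ := hline _ (isQuasiGeodesicOn_joinRays hσ hτ h0 hDc hdiv)
    hMorse
  have hjτ : RaysNear D (joinRays σ τ) τ := RaysNear.of_dist_le fun u hu => by
    rwa [joinRays_of_nonneg _ _ hu, dist_self]
  have hjσ : RaysNear D (fun t => joinRays σ τ (-t)) σ := RaysNear.of_dist_le fun u hu => by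
    rcases (show (0 : ℝ) ≤ u from hu).eq_or_lt with h | h
    · rwa [← h, neg_zero, hj0, dist_comm]
    · rwa [joinRays_of_neg _ _ (by linarith), neg_neg, dist_self]
  exact ⟨g, R + D, hg, hNg, by rwa [← hj0], hpos.trans hjτ, hneg.trans hjσ⟩

/-- Degenerate segments let richness produce a Morse line near an arbitrary point. A quasi-geodesic
with equal endpoints has parameter length at most `K * C`, whence the gauge. -/
theorem exists_gauge_singleton (X : Type*) [MetricSpace X] :
    ∃ N : MorseGauge, ∀ x : X, JoinedByMorse N x x := by
  refine ⟨_, fun x => ⟨0, fun _ => x, ?_, rfl, rfl, IsMorse.of_exists_dist_le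
    (φ := fun K C => K * (K * C) + C) ?_⟩⟩
  · refine Isometry.of_dist_eq fun u v => ?_
    have : u = v := Subtype.ext (by
      have h1 := u.2
      have h2 := v.2
      simp only [NNReal.coe_zero, Icc_self, mem_singleton_iff] at h1 h2
      rw [h1, h2])
    rw [this, dist_self, dist_self]
  · rintro K C a b q hq ⟨_, ha⟩ ⟨_, hb⟩ t ht
    have hab : a ≤ b := ht.1.trans ht.2
    have hK := hq.1
    refine ⟨x, ⟨⟨0, by simp⟩, rfl⟩, ?_⟩
    have h1 := hq.lower (v := a) (w := b) ⟨le_rfl, hab⟩ ⟨hab, le_rfl⟩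
    rw [← ha, ← hb, dist_self, abs_sub_comm, abs_of_nonneg (by linarith), zero_add] at h1
    have h2 := hq.upper (v := t) (w := a) ht ⟨le_rfl, hab⟩
    rw [← ha, abs_of_nonneg (by linarith [ht.1])] at h2
    have h3 : K * (t - a) ≤ K * (K * C) :=
      mul_le_mul_of_nonneg_left (by linarith [ht.2]) (by linarith)
    linarith

theorem exists_translate {N : MorseGauge} {α : ℝ → X} (hα : Isometry α)
    (hN : IsMorse N (range α)) {x : X} {C : ℝ} (h : infDist x (range α) < C) :
    ∃ β : ℝ → X, Isometry β ∧ IsMorse N (range β) ∧ range β = range α ∧ dist x (β 0) ≤ C := by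
  obtain ⟨_, ⟨s, rfl⟩, hs⟩ := (infDist_lt_iff (range_nonempty α)).1 h
  have hr : range (fun t => α (t + s)) = range α :=
    (IsometryEquiv.addRight s).surjective.range_comp α
  exact ⟨fun t => α (t + s), hα.comp (IsometryEquiv.addRight s).isometry, by rwa [hr], hr,
    by simpa only [zero_add] using hs.le⟩

theorem joinedByMorse_of_image_Icc {N : MorseGauge} {α : ℝ → X} (hα : Isometry α) {T : ℝ}
    (hT : 0 ≤ T) (hN : IsMorse N (α '' Icc 0 T)) : JoinedByMorse N (α 0) (α T) := by
  refine ⟨⟨T, hT⟩, fun u => α u, hα.comp isometry_subtype_coe, rfl, rfl, ?_⟩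
  convert hN using 1
  rw [image_eq_range]
  rfl

theorem MorseGeodesicallyRich.centerExhaustive [ProperSpace X] (hX : IsGeodesicSpace X)
    (h : MorseGeodesicallyRich X) : CenterExhaustive X := by
  obtain ⟨N₀, D, hD, hrich⟩ := h
  obtain ⟨N₁, hN₁⟩ := exists_gauge_halves X N₀
  obtain ⟨Npt, hNpt⟩ := exists_gauge_singleton X
  obtain ⟨C₂, hC₂⟩ := hrich Npt
  obtain ⟨C₁, hC₁⟩ := hrich N₁
  set R : ℝ := N₁ 3 (2 + 2 * D) + 1 + D with hR
  have hR0 : 0 ≤ R := by positivity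
  -- `C₁ + R ≤ T` keeps all of `β` away from `α T`; `3 * R + D < T` prevents both halves of `β` from
  -- approaching `α (-T)`.
  set T := |C₁| + 3 * R + D + 1 with hT
  have hT0 : 0 ≤ T := by positivity
  have hTC : C₁ + R ≤ T := by linarith [le_abs_self C₁]
  have hTR : 3 * R + D < T := by linarith [abs_nonneg C₁]
  set c := 2 + 2 * T + D with hc
  obtain ⟨R', N₂, hR', hline⟩ := exists_line_joining_rays hX N₁ hD.le (show D ≤ c by linarith)
  obtain ⟨N₃, hN₃⟩ := exists_gauge_morseTuples hX (fun K C => max (N₀ K C) (N₂ K C))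
  refine ⟨N₃, 2 * D + R', by positivity, fun x => ?_⟩
  obtain ⟨α₀, hα₀, hNα₀, hxα₀, -⟩ := hC₂ x x (hNpt x)
  obtain ⟨α, hα, hNα, -, hxα⟩ := exists_translate hα₀ hNα₀ hxα₀
  obtain ⟨hNαpos, hNαneg, hseg⟩ := hN₁ α hα hNα
  obtain ⟨β₀, hβ₀, hNβ₀, hxβ₀, hfar⟩ := hC₁ (α 0) (α T)
    (joinedByMorse_of_image_Icc hα hT0 (hseg T hT0))
  obtain ⟨β, hβ, hNβ, hrβ, hxβ⟩ := exists_translate hβ₀ hNβ₀ hxβ₀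
  rw [← hrβ, hα.dist_real, zero_sub, abs_neg, abs_of_nonneg hT0] at hfar
  have hdiv : ∀ u, R < dist (α T) (β u) := fun u => by
    linarith [infDist_le_dist_of_mem (x := α T) (mem_range_self (f := β) u), le_abs_self
      (T - infDist (α T) (range β))]
  -- If both halves of `β` came within `R` of `α (-T)`, the two points would be within `2 * R` of
  -- each other, hence within `2 * R` of `β 0` along `β`, giving `T ≤ 3 * R + D`.
  obtain ⟨τ, hτ, hNτ, hτ0, hτpos, hτneg⟩ : ∃ τ : ℝ → X, Isometry τ ∧ IsMorse N₁ (τ '' Ici 0) ∧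
      dist (α 0) (τ 0) ≤ D ∧ (∀ u ≥ 0, R < dist (α T) (τ u)) ∧
      ∀ u ≥ 0, R < dist (α (-T)) (τ u) := by
    obtain ⟨h1, h2, -⟩ := hN₁ β hβ hNβ
    by_cases h : ∀ u ≥ 0, R < dist (α (-T)) (β u)
    · exact ⟨β, hβ, h1, hxβ, fun u _ => hdiv u, h⟩
    · push Not at h
      obtain ⟨u, hu, hud⟩ := h
      refine ⟨fun t => β (-t), hβ.comp_neg_real, h2, by simpa using hxβ, fun u _ => hdiv _,
        fun v hv => ?_⟩
      by_contra! hvd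
      have h3 := dist_triangle_left (β u) (β (-v)) (α (-T))
      rw [hβ.dist_real, sub_neg_eq_add, abs_of_nonneg (by linarith)] at h3
      have h4 := dist_triangle4 (α 0) (β 0) (β u) (α (-T))
      rw [hα.dist_real, hβ.dist_real, zero_sub, zero_sub, neg_neg, abs_neg, abs_of_nonneg hT0,
        abs_of_nonneg hu, dist_comm (β u)] at h4
      linarith
  have hneg0 : dist (α (-0)) (τ 0) ≤ D := by rwa [neg_zero]
  obtain ⟨g, H, hg, hNg, hg0, hg1, hg2⟩ := hline α τ hα hτ hNαpos hNτ hτ0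
    fun s hs t ht => hNτ.add_le_of_diverge hX hα hτ hτ0 hτpos hT0 hs ht
  obtain ⟨k, H', hk, hNk, hk0, hk1, hk2⟩ := hline _ τ hα.comp_neg_real hτ hNαneg hNτ hneg0
    fun s hs t ht => hNτ.add_le_of_diverge hX hα.comp_neg_real hτ hneg0 hτneg hT0 hs ht
  obtain ⟨p, q, hαL⟩ := exists_isLineFromTo hα hNα
  obtain ⟨-, r, -, -, hgr⟩ := exists_isLineFromTo hg hNg
  have hgL : IsLineFromTo g q r := ⟨hg, hg2.convergesTo hαL.2.2, hgr⟩
  have hkL : IsLineFromTo k p r := by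
    refine ⟨hk, ?_, (hk1.trans hg1.symm).convergesTo hgr⟩
    exact RaysNear.convergesTo (α := fun t => k (-t)) (β := fun t => α (-t)) hk2 hαL.2.1
  have hnear : ∀ δ : ℝ → X, dist (δ 0) (τ 0) ≤ R' → x ∈ cthickening (2 * D + R') (range δ) := by
    intro δ hδ
    refine mem_cthickening_of_dist_le _ _ _ _ (mem_range_self 0) ?_
    rw [dist_comm] at hδ
    linarith [dist_triangle4 x (α 0) (τ 0) (δ 0)]
  refine ⟨p, q, r, hN₃ α g (fun t => k (-t)) p q r hαL hgL hkL.reverse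
    (hNα.mono fun K C => le_max_left _ _) (hNg.mono fun K C => le_max_right _ _) ?_,
    α, g, fun t => k (-t), hαL, hgL, hkL.reverse, ?_, hnear g hg0, hnear _ (by rwa [neg_zero])⟩
  · rw [range_comp_neg_real]
    exact hNk.mono fun K C => le_max_right _ _
  · exact mem_cthickening_of_dist_le _ _ _ _ (mem_range_self 0) (by linarith)

end CenterExhaustive

theorem mainTheorem5 {X Y : Type*} [MetricSpace X] [ProperSpace X] [MetricSpace Y] [ProperSpace Y]
    (hX : IsGeodesicSpace X) (hY : IsGeodesicSpace Y) (f : X → Y) (hf : IsQuasiIsometry f) :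
    (CenterExhaustive X → CenterExhaustive Y) ∧
      (CenterExhaustive X ↔ MorseGeodesicallyRich X) ∧
      (MorseGeodesicallyRich X → MorseGeodesicallyRich Y) :=
  ⟨fun h => h.of_isQuasiIsometry hY hf,
    ⟨fun h => h.morseGeodesicallyRich hX, fun h => h.centerExhaustive hX⟩,
    fun h => ((h.centerExhaustive hX).of_isQuasiIsometry hY hf).morseGeodesicallyRich hY⟩
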